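/- Let $\mathbb{K}$ be an algebraically closed field, $V$ a $\mathbb{K}$-vector space of finite dimension $r$, and $n\ge 0$ an integer. Let $\mathbb{K}[\epsilon]$, $\epsilon^2=0$, act on $V\oplus\epsilon V$ by $\epsilon\cdot(v+\epsilon w)=\epsilon v$, let $\pi: V\oplus\epsilon V\to V$ be the projection $v+\epsilon w\mapsto v$, and let $$\Sigma=\{[L]\in \mathrm{Gr}(n,V\oplus\epsilon V)\ |\ \epsilon L\subset L\}$$ be the variety of $n$-dimensional $\mathbb{K}[\epsilon]$-submodules of $V\oplus\epsilon V$, with the structure induced from the Grassmannian of $n$-dimensional subspaces. For $[L]\in\Sigma$ put $F=\pi(L)$ and define $G\subset V$ by $\epsilon G=L\cap\epsilon V$; then $F\subset G$ and $\dim F+\dim G=n$. Put $a=\max(0,n-r)$ and, for an integer $i$, $\Sigma_i=\{[L]\in\Sigma\ |\ \dim F=i\}$. 1. There is a decomposition into a disjoint union $$\Sigma=\bigsqcup_{i=a}^{\lfloor n/2\rfloor}\Sigma_i .$$ For $a\le i\le\lfloor n/2\rfloor$, the map $\Sigma_i\to\mathrm{Flag}(i,n-i,V)$, $[L]\mapsto(F\subset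 G)$, to the variety of flags $F\subset G\subset V$ with $\dim F=i$ and $\dim G=n-i$, makes $\Sigma_i$ the total space of an algebraic vector bundle whose fiber over $(F\subset G)$ is $\mathrm{Hom}(F,V/G)$, where $\varphi\in\mathrm{Hom}(F,V/G)$ corresponds to the submodule $L_\varphi=\{v+\epsilon w\ |\ v\in F,\ \varphi(v)=w \bmod G\}$. 2. For every integer $l$ with $a\le l\le\lfloor n/2\rfloor$, the closure $\overline{\Sigma}_l$ of $\Sigma_l$ in $\Sigma$ (for the Zariski topology) is $$\overline{\Sigma}_l=\bigsqcup_{i=a}^{l}\Sigma_i,\qquad\text{and}\qquad \dim\overline{\Sigma}_l=n(r-n+l)+l(n-2l).$$ -/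

import Mathlib

open Set Filter Topology

/-! ## Spaces with functions, and their morphisms -/

/-- A space with functions over a field `K`: a topological space with a sheaf of `K`-algebras of
`K`-valued functions such that, for a section `f`, the set `f ≠ 0` is open and `1 / f` is a
section on it.  The sheaf is given by the predicate "`f` is regular near `x`" : a function is a
section over an open set `U` when it is regular at all points of `U`. -/
class SpaceWithFunctions (K : Type*) [Field K] (X : Type*) [TopologicalSpace X] where
  RegularAt : (X → K) → X → Prop
  congr : ∀ {f g : X → K} {x : X}, RegularAt f x → f =ᶠ[𝓝 x] g → RegularAt g x
  eventually : ∀ {f : X → K} {x : X}, RegularAt f x → ∀ᶠ y in 𝓝 x, RegularAt f y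
  const : ∀ (c : K) (x : X), RegularAt (fun _ => c) x
  add : ∀ {f g : X → K} {x : X}, RegularAt f x → RegularAt g x →
    RegularAt (fun y => f y + g y) x
  mul : ∀ {f g : X → K} {x : X}, RegularAt f x → RegularAt g x →
    RegularAt (fun y => f y * g y) x
  ne_zero : ∀ {f : X → K} {x : X}, RegularAt f x → f x ≠ 0 → ∀ᶠ y in 𝓝 x, f y ≠ 0
  inv : ∀ {f : X → K} {x : X}, RegularAt f x → f x ≠ 0 → RegularAt (fun y => (f y)⁻¹) x

/-- `f` is a regular function in a neighbourhood of `x`. -/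
def RegularAt (K : Type*) [Field K] {X : Type*} [TopologicalSpace X] [SpaceWithFunctions K X]
    (f : X → K) (x : X) : Prop :=
  SpaceWithFunctions.RegularAt f x

/-- A morphism: a continuous map that pulls regular functions back to regular functions. -/
def IsMorphism (K : Type*) [Field K] {X Y : Type*}
    [TopologicalSpace X] [SpaceWithFunctions K X] [TopologicalSpace Y] [SpaceWithFunctions K Y]
    (φ : X → Y) : Prop :=
  Continuous φ ∧ ∀ (x : X) (f : Y → K), RegularAt K f (φ x) → RegularAt K (fun y => f (φ y)) x

/-! ## Affine spaces -/

/-- A vector space regarded as an affine space with its Zariski topology. -/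
def AffineSp (K : Type*) [Field K] (A : Type*) [AddCommGroup A] [Module K A] : Type _ := A

/-- The polynomial functions on a vector space: the algebra generated by the linear forms. -/
def polyFun (K : Type*) [Field K] (A : Type*) [AddCommGroup A] [Module K A] :
    Subalgebra K (A → K) :=
  Algebra.adjoin K (Set.range fun l : Module.Dual K A => (fun a => l a))

section Affine

variable {K : Type*} [Field K] {A : Type*} [AddCommGroup A] [Module K A]

/-- Zariski topology: the sets `p ≠ 0`, with `p` polynomial, form a basis. -/
instance : TopologicalSpace (AffineSp K A) where
  IsOpen U := ∀ a ∈ U, ∃ p ∈ polyFun K A, p a ≠ 0 ∧ ∀ b : A, p b ≠ 0 → b ∈ U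
  isOpen_univ := fun a _ => ⟨1, one_mem _, one_ne_zero, fun _ _ => mem_univ _⟩
  isOpen_inter := by
    rintro s t hs ht a ⟨has, hat⟩
    obtain ⟨p, hp, hpa, hps⟩ := hs a has
    obtain ⟨q, hq, hqa, hqt⟩ := ht a hat
    exact ⟨p * q, mul_mem hp hq, mul_ne_zero hpa hqa, fun b hb =>
      ⟨hps b (left_ne_zero_of_mul hb), hqt b (right_ne_zero_of_mul hb)⟩⟩
  isOpen_sUnion := by
    rintro S hS a ⟨s, hs, has⟩
    obtain ⟨p, hp, hpa, hps⟩ := hS s hs a has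
    exact ⟨p, hp, hpa, fun b hb => ⟨s, hs, hps b hb⟩⟩

theorem AffineSp.eventually_ne_zero {p : A → K} (hp : p ∈ polyFun K A) {a : AffineSp K A}
    (ha : p a ≠ 0) : ∀ᶠ b : AffineSp K A in 𝓝 a, p b ≠ 0 :=
  IsOpen.mem_nhds (s := {b : AffineSp K A | p b ≠ 0})
    (fun _ hb => ⟨p, hp, hb, fun _ h => h⟩) ha

theorem AffineSp.exists_of_eventually {P : A → Prop} {a : AffineSp K A}
    (h : ∀ᶠ b : AffineSp K A in 𝓝 a, P b) :
    ∃ p ∈ polyFun K A, p a ≠ 0 ∧ ∀ b : A, p b ≠ 0 → P b := by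
  obtain ⟨s, hs, hso, has⟩ := eventually_nhds_iff.1 h
  obtain ⟨p, hp, hpa, hps⟩ := hso a has
  exact ⟨p, hp, hpa, fun b hb => hs b (hps b hb)⟩

/-- A function is regular at `a` when it is a quotient of polynomials near `a`. -/
instance : SpaceWithFunctions K (AffineSp K A) where
  RegularAt f a := ∃ p ∈ polyFun K A, ∃ q ∈ polyFun K A, q a ≠ 0 ∧
    ∀ᶠ b : AffineSp K A in 𝓝 a, f b = p b / q b
  congr := by
    rintro f g a ⟨p, hp, q, hq, hqa, h⟩ hfg
    exact ⟨p, hp, q, hq, hqa, by filter_upwards [h, hfg] with b h1 h2; rw [← h2, h1]⟩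
  eventually := by
    rintro f a ⟨p, hp, q, hq, hqa, h⟩
    filter_upwards [eventually_eventually_nhds.2 h, AffineSp.eventually_ne_zero hq hqa]
      with b h1 h2
    exact ⟨p, hp, q, hq, h2, h1⟩
  const := fun c a => ⟨algebraMap K _ c, Subalgebra.algebraMap_mem _ c, 1, one_mem _, one_ne_zero,
    Eventually.of_forall fun b => (div_one c).symm⟩
  add := by
    rintro f g a ⟨p, hp, q, hq, hqa, h⟩ ⟨p', hp', q', hq', hqa', h'⟩
    refine ⟨p * q' + q * p', add_mem (mul_mem hp hq') (mul_mem hq hp'), q * q', mul_mem hq hq',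
      mul_ne_zero hqa hqa', ?_⟩
    filter_upwards [h, h', AffineSp.eventually_ne_zero hq hqa,
      AffineSp.eventually_ne_zero hq' hqa'] with b h1 h2 h3 h4
    rw [h1, h2, div_add_div _ _ h3 h4]
    rfl
  mul := by
    rintro f g a ⟨p, hp, q, hq, hqa, h⟩ ⟨p', hp', q', hq', hqa', h'⟩
    refine ⟨p * p', mul_mem hp hp', q * q', mul_mem hq hq', mul_ne_zero hqa hqa', ?_⟩
    filter_upwards [h, h'] with b h1 h2
    rw [h1, h2, div_mul_div_comm]
    rfl
  ne_zero := by
    rintro f a ⟨p, hp, q, hq, hqa, h⟩ hfa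
    have hpa : p a ≠ 0 := by
      intro h0
      exact hfa (by rw [h.self_of_nhds, h0, zero_div])
    filter_upwards [h, AffineSp.eventually_ne_zero hq hqa,
      AffineSp.eventually_ne_zero hp hpa] with b h1 h2 h3
    rw [h1]
    exact div_ne_zero h3 h2
  inv := by
    rintro f a ⟨p, hp, q, hq, hqa, h⟩ hfa
    have hpa : p a ≠ 0 := by
      intro h0
      exact hfa (by rw [h.self_of_nhds, h0, zero_div])
    refine ⟨q, hq, p, hp, hpa, ?_⟩
    filter_upwards [h] with b h1
    rw [h1, inv_div]

end Affine

/-! ## Subspaces, products and quotients -/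

/-- Subspaces: regular functions are locally restrictions of regular functions. -/
instance {K : Type*} [Field K] {X : Type*} [TopologicalSpace X] [SpaceWithFunctions K X]
    {P : X → Prop} : SpaceWithFunctions K {x : X // P x} where
  RegularAt f x := ∃ g : X → K, RegularAt K g x ∧ ∀ᶠ y : {x : X // P x} in 𝓝 x, f y = g y
  congr := by
    rintro f f' x ⟨g, hg, h⟩ hf
    exact ⟨g, hg, by filter_upwards [h, hf] with y h1 h2; rw [← h2, h1]⟩
  eventually := by
    rintro f x ⟨g, hg, h⟩
    filter_upwards [eventually_eventually_nhds.2 h,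
      continuous_subtype_val.continuousAt.eventually (SpaceWithFunctions.eventually hg)]
      with y h1 h2
    exact ⟨g, h2, h1⟩
  const := fun c x => ⟨fun _ => c, SpaceWithFunctions.const c _, Eventually.of_forall fun _ => rfl⟩
  add := by
    rintro f f' x ⟨g, hg, h⟩ ⟨g', hg', h'⟩
    exact ⟨_, SpaceWithFunctions.add hg hg', by
      filter_upwards [h, h'] with y h1 h2; rw [h1, h2]⟩
  mul := by
    rintro f f' x ⟨g, hg, h⟩ ⟨g', hg', h'⟩
    exact ⟨_, SpaceWithFunctions.mul hg hg', by
      filter_upwards [h, h'] with y h1 h2; rw [h1, h2]⟩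
  ne_zero := by
    rintro f x ⟨g, hg, h⟩ hf
    rw [h.self_of_nhds] at hf
    filter_upwards [h,
      continuous_subtype_val.continuousAt.eventually (SpaceWithFunctions.ne_zero hg hf)]
      with y h1 h2
    rw [h1]
    exact h2
  inv := by
    rintro f x ⟨g, hg, h⟩ hf
    rw [h.self_of_nhds] at hf
    exact ⟨_, SpaceWithFunctions.inv hg hf, by filter_upwards [h] with y h1; rw [h1]⟩

/-- The quotient structure on `Y` along `q : X → Y` : a set is open when its preimage is open, and
a function `f` on `Y` is regular on an open set when `f ∘ q` is regular on its preimage. -/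
@[reducible] def SpaceWithFunctions.coinduced (K : Type*) [Field K] {X Y : Type*}
    [tX : TopologicalSpace X] [SpaceWithFunctions K X] (q : X → Y) :
    @SpaceWithFunctions K _ Y (tX.coinduced q) :=
  letI : TopologicalSpace Y := tX.coinduced q
  have hq : Continuous q := continuous_coinduced_rng
  have key : ∀ {f : Y → K} {y : Y}, (∀ᶠ z in 𝓝 y, ∀ x, q x = z →
      _root_.RegularAt K (fun x => f (q x)) x) → f y ≠ 0 → ∀ᶠ z in 𝓝 y, f z ≠ 0 := by
    intro f y h hf
    obtain ⟨U, hU, hUo, hyU⟩ := eventually_nhds_iff.1 h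
    refine eventually_nhds_iff.2 ⟨U ∩ {z | f z ≠ 0}, fun z hz => hz.2, ?_, hyU, hf⟩
    refine isOpen_coinduced.2 (isOpen_iff_mem_nhds.2 fun x hx => ?_)
    have h1 := hU (q x) hx.1 x rfl
    filter_upwards [SpaceWithFunctions.ne_zero h1 hx.2,
      hq.continuousAt.preimage_mem_nhds (hUo.mem_nhds hx.1)] with x' h2 h3
    exact ⟨h3, h2⟩
  { RegularAt := fun f y => ∀ᶠ z in 𝓝 y, ∀ x, q x = z → _root_.RegularAt K (fun x => f (q x)) x
    congr := by
      intro f g y h hfg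
      filter_upwards [h, eventually_eventually_nhds.2 hfg] with z h1 h2 x hx
      subst hx
      exact SpaceWithFunctions.congr (h1 x rfl) (hq.continuousAt.eventually h2)
    eventually := fun h => eventually_eventually_nhds.2 h
    const := fun c y => Eventually.of_forall fun _ _ _ => SpaceWithFunctions.const c _
    add := by
      intro f g y h h'
      filter_upwards [h, h'] with z h1 h2 x hx
      exact SpaceWithFunctions.add (h1 x hx) (h2 x hx)
    mul := by
      intro f g y h h'
      filter_upwards [h, h'] with z h1 h2 x hx
      exact SpaceWithFunctions.mul (h1 x hx) (h2 x hx)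
    ne_zero := key
    inv := by
      intro f y h hf
      filter_upwards [h, key h hf] with z h1 h2 x hx
      subst hx
      exact SpaceWithFunctions.inv (h1 x rfl) h2 }

/-- The underlying set of the product of two spaces with functions (its topology is finer than the
product topology). -/
structure ProdSp (K : Type*) (X Y : Type*) where
  fst : X
  snd : Y

section Product

variable {K : Type*} [Field K] {X Y : Type*}
  [TopologicalSpace X] [SpaceWithFunctions K X] [TopologicalSpace Y] [SpaceWithFunctions K Y]

/-- `h` is a finite sum `∑ f k x * g k y` on `U × V`, with `f k` regular on `U` and `g k` regular
on `V`. -/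
def IsTensorOn (U : Set X) (V : Set Y) (h : ProdSp K X Y → K) : Prop :=
  ∃ (ι : Type) (_ : Fintype ι) (f : ι → X → K) (g : ι → Y → K),
    (∀ k, ∀ x ∈ U, RegularAt K (f k) x) ∧ (∀ k, ∀ y ∈ V, RegularAt K (g k) y) ∧
    ∀ x ∈ U, ∀ y ∈ V, h ⟨x, y⟩ = ∑ k, f k x * g k y

theorem IsTensorOn.mono {U U' : Set X} {V V' : Set Y} {h : ProdSp K X Y → K}
    (H : IsTensorOn U V h) (hU : U' ⊆ U) (hV : V' ⊆ V) : IsTensorOn U' V' h := by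
  obtain ⟨ι, _, f, g, hf, hg, e⟩ := H
  exact ⟨ι, _, f, g, fun k x hx => hf k x (hU hx), fun k y hy => hg k y (hV hy),
    fun x hx y hy => e x (hU hx) y (hV hy)⟩

theorem IsTensorOn.const (U : Set X) (V : Set Y) (c : K) :
    IsTensorOn U V (fun _ : ProdSp K X Y => c) :=
  ⟨Unit, inferInstance, fun _ _ => c, fun _ _ => 1, fun _ _ _ => SpaceWithFunctions.const c _,
    fun _ _ _ => SpaceWithFunctions.const 1 _, fun _ _ _ _ => by simp⟩

theorem IsTensorOn.add {U : Set X} {V : Set Y} {h h' : ProdSp K X Y → K}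
    (H : IsTensorOn U V h) (H' : IsTensorOn U V h') : IsTensorOn U V (fun z => h z + h' z) := by
  obtain ⟨ι, _, f, g, hf, hg, e⟩ := H
  obtain ⟨ι', _, f', g', hf', hg', e'⟩ := H'
  refine ⟨ι ⊕ ι', inferInstance, Sum.elim f f', Sum.elim g g', ?_, ?_, ?_⟩
  · rintro (k | k) <;> [exact hf k; exact hf' k]
  · rintro (k | k) <;> [exact hg k; exact hg' k]
  · intro x hx y hy
    simp [e x hx y hy, e' x hx y hy]

theorem IsTensorOn.mul {U : Set X} {V : Set Y} {h h' : ProdSp K X Y → K}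
    (H : IsTensorOn U V h) (H' : IsTensorOn U V h') : IsTensorOn U V (fun z => h z * h' z) := by
  obtain ⟨ι, _, f, g, hf, hg, e⟩ := H
  obtain ⟨ι', _, f', g', hf', hg', e'⟩ := H'
  refine ⟨ι × ι', inferInstance, fun k x => f k.1 x * f' k.2 x, fun k y => g k.1 y * g' k.2 y,
    fun k x hx => SpaceWithFunctions.mul (hf k.1 x hx) (hf' k.2 x hx),
    fun k y hy => SpaceWithFunctions.mul (hg k.1 y hy) (hg' k.2 y hy), ?_⟩
  intro x hx y hy
  simp only [e x hx y hy, e' x hx y hy, Finset.sum_mul_sum, Fintype.sum_prod_type]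
  exact Finset.sum_congr rfl fun _ _ => Finset.sum_congr rfl fun _ _ => by ring

/-- The sets `{(x, y) ∈ U × V | h (x, y) ≠ 0}`, with `U`, `V` open and `h` as above, form a
basis. -/
instance : TopologicalSpace (ProdSp K X Y) where
  IsOpen W := ∀ z ∈ W, ∃ U V, IsOpen U ∧ IsOpen V ∧ z.fst ∈ U ∧ z.snd ∈ V ∧
    ∃ h : ProdSp K X Y → K, IsTensorOn U V h ∧ h z ≠ 0 ∧
      ∀ w : ProdSp K X Y, w.fst ∈ U → w.snd ∈ V → h w ≠ 0 → w ∈ W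
  isOpen_univ := fun _ _ => ⟨univ, univ, isOpen_univ, isOpen_univ, mem_univ _, mem_univ _,
    fun _ => 1, IsTensorOn.const _ _ _, one_ne_zero, fun _ _ _ _ => mem_univ _⟩
  isOpen_inter := by
    rintro s t hs ht z ⟨hzs, hzt⟩
    obtain ⟨U, V, hU, hV, hzU, hzV, h, H, hz, hw⟩ := hs z hzs
    obtain ⟨U', V', hU', hV', hzU', hzV', h', H', hz', hw'⟩ := ht z hzt
    exact ⟨U ∩ U', V ∩ V', hU.inter hU', hV.inter hV', ⟨hzU, hzU'⟩, ⟨hzV, hzV'⟩, _,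
      (H.mono inter_subset_left inter_subset_left).mul
        (H'.mono inter_subset_right inter_subset_right), mul_ne_zero hz hz',
      fun w h1 h2 h3 => ⟨hw w h1.1 h2.1 (left_ne_zero_of_mul h3),
        hw' w h1.2 h2.2 (right_ne_zero_of_mul h3)⟩⟩
  isOpen_sUnion := by
    rintro S hS z ⟨s, hs, hzs⟩
    obtain ⟨U, V, hU, hV, hzU, hzV, h, H, hz, hw⟩ := hS s hs z hzs
    exact ⟨U, V, hU, hV, hzU, hzV, h, H, hz, fun w h1 h2 h3 => ⟨s, hs, hw w h1 h2 h3⟩⟩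

theorem IsTensorOn.eventually {U : Set X} {V : Set Y} {h : ProdSp K X Y → K}
    (H : IsTensorOn U V h) (hU : IsOpen U) (hV : IsOpen V) {z : ProdSp K X Y}
    (hzU : z.fst ∈ U) (hzV : z.snd ∈ V) (hz : h z ≠ 0) :
    ∀ᶠ w in 𝓝 z, w.fst ∈ U ∧ w.snd ∈ V ∧ h w ≠ 0 :=
  IsOpen.mem_nhds (s := {w : ProdSp K X Y | w.fst ∈ U ∧ w.snd ∈ V ∧ h w ≠ 0})
    (fun _ hw => ⟨U, V, hU, hV, hw.1, hw.2.1, h, H, hw.2.2, fun _ h1 h2 h3 => ⟨h1, h2, h3⟩⟩)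
    ⟨hzU, hzV, hz⟩

/-- A function on the product is regular at a point when it is a quotient of functions as above
near that point. -/
instance : SpaceWithFunctions K (ProdSp K X Y) where
  RegularAt F z := ∃ U V, IsOpen U ∧ IsOpen V ∧ z.fst ∈ U ∧ z.snd ∈ V ∧
    ∃ p q : ProdSp K X Y → K, IsTensorOn U V p ∧ IsTensorOn U V q ∧ q z ≠ 0 ∧
      ∀ᶠ w in 𝓝 z, F w = p w / q w
  congr := by
    rintro F G z ⟨U, V, hU, hV, hzU, hzV, p, q, hp, hq, hqz, h⟩ hFG
    exact ⟨U, V, hU, hV, hzU, hzV, p, q, hp, hq, hqz, by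
      filter_upwards [h, hFG] with w h1 h2; rw [← h2, h1]⟩
  eventually := by
    rintro F z ⟨U, V, hU, hV, hzU, hzV, p, q, hp, hq, hqz, h⟩
    filter_upwards [eventually_eventually_nhds.2 h, hq.eventually hU hV hzU hzV hqz] with w h1 h2
    exact ⟨U, V, hU, hV, h2.1, h2.2.1, p, q, hp, hq, h2.2.2, h1⟩
  const := fun c z => ⟨univ, univ, isOpen_univ, isOpen_univ, mem_univ _, mem_univ _, fun _ => c,
    fun _ => 1, IsTensorOn.const _ _ _, IsTensorOn.const _ _ _, one_ne_zero,
    Eventually.of_forall fun _ => by simp⟩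
  add := by
    rintro F G z ⟨U, V, hU, hV, hzU, hzV, p, q, hp, hq, hqz, h⟩
      ⟨U', V', hU', hV', hzU', hzV', p', q', hp', hq', hqz', h'⟩
    have hp := hp.mono (U' := U ∩ U') (V' := V ∩ V') inter_subset_left inter_subset_left
    have hq1 := hq.mono (U' := U ∩ U') (V' := V ∩ V') inter_subset_left inter_subset_left
    have hp' := hp'.mono (U' := U ∩ U') (V' := V ∩ V') inter_subset_right inter_subset_right
    have hq1' := hq'.mono (U' := U ∩ U') (V' := V ∩ V') inter_subset_right inter_subset_right
    refine ⟨U ∩ U', V ∩ V', hU.inter hU', hV.inter hV', ⟨hzU, hzU'⟩, ⟨hzV, hzV'⟩, _, _,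
      (hp.mul hq1').add (hq1.mul hp'), hq1.mul hq1', mul_ne_zero hqz hqz', ?_⟩
    filter_upwards [h, h', hq.eventually hU hV hzU hzV hqz,
      hq'.eventually hU' hV' hzU' hzV' hqz'] with w h1 h2 h3 h4
    rw [h1, h2, div_add_div _ _ h3.2.2 h4.2.2]
  mul := by
    rintro F G z ⟨U, V, hU, hV, hzU, hzV, p, q, hp, hq, hqz, h⟩
      ⟨U', V', hU', hV', hzU', hzV', p', q', hp', hq', hqz', h'⟩
    have hp := hp.mono (U' := U ∩ U') (V' := V ∩ V') inter_subset_left inter_subset_left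
    have hq1 := hq.mono (U' := U ∩ U') (V' := V ∩ V') inter_subset_left inter_subset_left
    have hp' := hp'.mono (U' := U ∩ U') (V' := V ∩ V') inter_subset_right inter_subset_right
    have hq1' := hq'.mono (U' := U ∩ U') (V' := V ∩ V') inter_subset_right inter_subset_right
    refine ⟨U ∩ U', V ∩ V', hU.inter hU', hV.inter hV', ⟨hzU, hzU'⟩, ⟨hzV, hzV'⟩, _, _,
      hp.mul hp', hq1.mul hq1', mul_ne_zero hqz hqz', ?_⟩
    filter_upwards [h, h'] with w h1 h2
    rw [h1, h2, div_mul_div_comm]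
  ne_zero := by
    rintro F z ⟨U, V, hU, hV, hzU, hzV, p, q, hp, hq, hqz, h⟩ hF
    have hpz : p z ≠ 0 := by
      intro h0
      exact hF (by rw [h.self_of_nhds, h0, zero_div])
    filter_upwards [h, hq.eventually hU hV hzU hzV hqz, hp.eventually hU hV hzU hzV hpz]
      with w h1 h2 h3
    rw [h1]
    exact div_ne_zero h3.2.2 h2.2.2
  inv := by
    rintro F z ⟨U, V, hU, hV, hzU, hzV, p, q, hp, hq, hqz, h⟩ hF
    have hpz : p z ≠ 0 := by
      intro h0
      exact hF (by rw [h.self_of_nhds, h0, zero_div])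
    refine ⟨U, V, hU, hV, hzU, hzV, q, p, hq, hp, hpz, ?_⟩
    filter_upwards [h] with w h1
    rw [h1, inv_div]

end Product

/-! ## Vector bundles -/

/-- Let `p : X → B` be a map whose fibre over each `b` is identified, by `θ b`, with a vector space
`E b`.  This makes `X` the total space of an (algebraic) vector bundle over `B` with fibres `E b`
when `p` is a morphism and each point of `B` has an open neighbourhood `U` with an isomorphism
`U × K ^ m ≅ p ⁻¹(U)` of spaces with functions over `U` that is linear on the fibres. -/
structure IsVectorBundle (K : Type*) [Field K] {X B : Type*}
    [TopologicalSpace X] [SpaceWithFunctions K X] [TopologicalSpace B] [SpaceWithFunctions K B]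
    (p : X → B) (E : B → Type*) [∀ b, AddCommGroup (E b)] [∀ b, Module K (E b)]
    (θ : ∀ b, E b ≃ {x : X // p x = b}) : Prop where
  isMorphism : IsMorphism K p
  locallyTrivial : ∀ b : B, ∃ U : Set B, IsOpen U ∧ b ∈ U ∧
    ∃ (m : ℕ) (τ : ProdSp K U (AffineSp K (Fin m → K)) ≃ {x : X // p x ∈ U}),
      IsMorphism K τ ∧ IsMorphism K τ.symm ∧
      (∀ u c, p (τ ⟨u, c⟩).1 = u.1) ∧
      ∀ u : U, ∃ e : (Fin m → K) ≃ₗ[K] E u.1, ∀ c : Fin m → K,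
        (τ ⟨u, c⟩).1 = (θ u.1 (e c)).1

/-! ## Grassmannians and flag varieties -/

/-- The set of `n`-dimensional subspaces of `W` (`Module.Grassmannian` instead fixes the rank of the
quotient). -/
def Gr (K : Type*) [Field K] (W : Type*) [AddCommGroup W] [Module K W] (n : ℕ) : Type _ :=
  {L : Submodule K W // Module.finrank K L = n}

/-- The linearly independent families of `n` vectors of `W`, as a subspace of the affine space
`W ^ n` (it is open when `W` is finite-dimensional). -/
def Frames (K : Type*) [Field K] (W : Type*) [AddCommGroup W] [Module K W] (n : ℕ) :
    Set (AffineSp K (Fin n → W)) :=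
  {w | LinearIndependent K (show Fin n → W from w)}

/-- The subspace spanned by a frame. -/
def frameSpan (K : Type*) [Field K] (W : Type*) [AddCommGroup W] [Module K W] (n : ℕ)
    (w : Frames K W n) : Gr K W n :=
  ⟨Submodule.span K (Set.range (show Fin n → W from w.1)), by
    rw [finrank_span_eq_card (show LinearIndependent K (show Fin n → W from w.1) from w.2),
      Fintype.card_fin]⟩

section Grassmannian

variable {K : Type*} [Field K] {W : Type*} [AddCommGroup W] [Module K W] {n : ℕ}

/-- The Zariski topology of the Grassmannian, as the quotient of the space of frames by `GL_n`. -/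
instance : TopologicalSpace (Gr K W n) :=
  TopologicalSpace.coinduced (frameSpan K W n) inferInstance

/-- The regular functions on the Grassmannian: those that are regular functions of a frame. -/
instance : SpaceWithFunctions K (Gr K W n) :=
  SpaceWithFunctions.coinduced K (frameSpan K W n)

end Grassmannian

/-- The variety of flags `F ⊆ G ⊆ V` with `dim F = i` and `dim G = j`, inside
`Gr(i, V) × Gr(j, V)`. -/
def FlagVar (K : Type*) [Field K] (V : Type*) [AddCommGroup V] [Module K V] (i j : ℕ) :
    Set (ProdSp K (Gr K V i) (Gr K V j)) :=
  {b | b.fst.1 ≤ b.snd.1}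

/-! ## Submodules of `V ⊕ εV` over the dual numbers -/

section DualNumbers

variable (K : Type*) [Field K] (V : Type*) [AddCommGroup V] [Module K V]

/-- Multiplication by `ε` on `V ⊕ εV`, where `v + εw` is written as the pair `(v, w)` : it maps
`v + εw` to `εv`. -/
def epsMul : (V × V) →ₗ[K] (V × V) :=
  LinearMap.inr K V V ∘ₗ LinearMap.fst K V V

/-- The variety `Σ` of `n`-dimensional subspaces `L` of `V ⊕ εV` with `εL ⊆ L`, that is, of
`n`-dimensional `K[ε]`-submodules. -/
def SigmaVar (n : ℕ) : Set (Gr K (V × V) n) :=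
  {L | L.1.map (epsMul K V) ≤ L.1}

variable {K V}

/-- `F = π(L)`, with `π : V ⊕ εV → V` the projection. -/
def piPart (L : Submodule K (V × V)) : Submodule K V :=
  L.map (LinearMap.fst K V V)

/-- `G`, defined by `εG = L ∩ εV`. -/
def epsPart (L : Submodule K (V × V)) : Submodule K V :=
  L.comap (LinearMap.inr K V V)

variable (K V)

/-- The stratum `Σ_i` of `Σ`, where `dim F = i`. -/
def stratum (n i : ℕ) : Set (SigmaVar K V n) :=
  {L | Module.finrank K (piPart L.1.1) = i}

variable {K V}

theorem piPart_le_epsPart {L : Submodule K (V × V)} (hL : L.map (epsMul K V) ≤ L) :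
    piPart L ≤ epsPart L := by
  rintro _ ⟨x, hx, rfl⟩
  exact hL ⟨x, hx, rfl⟩

theorem finrank_piPart_add_finrank_epsPart [FiniteDimensional K V] (L : Submodule K (V × V)) :
    Module.finrank K (piPart L) + Module.finrank K (epsPart L) = Module.finrank K L := by
  have h1 : Module.finrank K (piPart L) =
      Module.finrank K (LinearMap.range ((LinearMap.fst K V V).domRestrict L)) := by
    rw [LinearMap.range_domRestrict]
    rfl
  have h2 : Module.finrank K (epsPart L) =
      Module.finrank K (LinearMap.ker ((LinearMap.fst K V V).domRestrict L)) := by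
    refine LinearEquiv.finrank_eq (LinearEquiv.ofBijective
      (LinearMap.codRestrict _ (LinearMap.codRestrict L
        (LinearMap.inr K V V ∘ₗ (epsPart L).subtype) fun g => g.2) fun g => ?_) ⟨?_, ?_⟩)
    · rfl
    · intro g g' h
      have h := congrArg (fun z => z.1.1.2) h
      exact Subtype.ext h
    · rintro ⟨⟨⟨v, w⟩, hL⟩, hv⟩
      obtain rfl : v = 0 := hv
      exact ⟨⟨w, hL⟩, rfl⟩
  rw [h1, h2, LinearMap.finrank_range_add_finrank_ker]

/-- The map `Σ_i → Flag(i, n - i, V)`, `L ↦ (F ⊆ G)`. -/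
def flagOf [FiniteDimensional K V] {n i : ℕ} (L : stratum K V n i) : FlagVar K V i (n - i) :=
  ⟨⟨⟨piPart L.1.1.1, L.2⟩, ⟨epsPart L.1.1.1, by
    have h := finrank_piPart_add_finrank_epsPart L.1.1.1
    have h1 : Module.finrank K (piPart L.1.1.1) = i := L.2
    have h2 : Module.finrank K L.1.1.1 = n := L.1.1.2
    omega⟩⟩, piPart_le_epsPart L.1.2⟩

/-- The submodule attached to `φ : F → V / G` : the fibre product of `F` and `εV` over
`ε(V / G)`, that is, the set of all `v + εw` with `v ∈ F` and `φ v = w mod G`. -/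
def homSubmodule (F G : Submodule K V) (φ : F →ₗ[K] V ⧸ G) : Submodule K (V × V) where
  carrier := {x | ∃ h : x.1 ∈ F, φ ⟨x.1, h⟩ = G.mkQ x.2}
  zero_mem' := ⟨F.zero_mem, (map_zero φ).trans (map_zero G.mkQ).symm⟩
  add_mem' := by
    rintro x y ⟨hx, ex⟩ ⟨hy, ey⟩
    refine ⟨F.add_mem hx hy, ?_⟩
    rw [Prod.snd_add, map_add, ← ex, ← ey, ← map_add]
    rfl
  smul_mem' := by
    rintro c x ⟨hx, ex⟩
    refine ⟨F.smul_mem c hx, ?_⟩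
    rw [Prod.smul_snd, map_smul, ← ex, ← map_smul]
    rfl

end DualNumbers

/-! A subspace `L` of `V ⊕ εV` is the same thing as a triple `(F, G, φ)` with `φ : F → V/G`
(`exists_homSubmodule_eq`, `homSubmodule_injective`), and `εL ⊆ L` says exactly that `F ⊆ G`. Since
`dim F + dim G = n`, the inclusions `F ⊆ G` and `G ⊆ V` give the range of `dim F`.

Bundle structure. Near a given flag, split `V = A ⊕ M ⊕ C` with the flag equal to `A ⊆ A ⊕ M`.
Nearby flags consist of a graph over `A` and a graph over `A ⊕ M`, and the submodules above them are
graphs over `A ⊕ ε(A ⊕ M)` of block triangular maps. The nonzero blocks are the coordinates of `F`,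
of `G` and of `φ`. So passing between `L` and `(F, G, φ)` is linear in Grassmannian charts, which
gives both the morphism `L ↦ (F ⊆ G)` and the trivializations.

Closures. The condition `dim F ≤ l` is closed, by semicontinuity of rank. Conversely, let `t_j` be
scalars and consider the span of the vectors `t_j v_j + ε w_j`, `ε v_j` (`j < l`) and `ε u_k` (`k <
n - 2l`), wherever they are independent. It is always an `ε`-stable subspace with `dim F ≤ l`, with
equality when no `t_j` vanishes, and every point of `Σ` with `dim F ≤ l` occurs
(`exists_familySub_eq`). The parameter space is open in an affine space, hence irreducible, and the
locus where all `t_j ≠ 0` is dense in it. Therefore `{dim F ≤ l}` is the closure of the stratum, and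
it is irreducible.

Dimension. The closure is irreducible, locally a closed subset of an affine space, and contains a
nonempty open set homeomorphic to the affine space `Hom(A, M) × Hom(A ⊕ M, C) × Hom(A, C)`. Passing
to a nonempty open subset of an irreducible affine variety does not change the Krull dimension
(`topologicalKrullDim_le_of_isOpen`, from Noether normalization and the Nullstellensatz), so the
dimension is that of this affine space. -/

set_option linter.unusedSectionVars false

/-! ### Calculus of regular functions and morphisms. -/

section Regular

variable {K : Type*} [Field K] {X Y Z : Type*}
  [TopologicalSpace X] [SpaceWithFunctions K X] [TopologicalSpace Y] [SpaceWithFunctions K Y]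
  [TopologicalSpace Z] [SpaceWithFunctions K Z]

theorem RegularAt.congr {f g : X → K} {x : X} (hf : RegularAt K f x) (h : f =ᶠ[𝓝 x] g) :
    RegularAt K g x :=
  SpaceWithFunctions.congr hf h

theorem regularAt_const (c : K) (x : X) : RegularAt K (fun _ => c) x :=
  SpaceWithFunctions.const c x

theorem RegularAt.add {f g : X → K} {x : X} (hf : RegularAt K f x) (hg : RegularAt K g x) :
    RegularAt K (fun y => f y + g y) x :=
  SpaceWithFunctions.add hf hg

theorem RegularAt.mul {f g : X → K} {x : X} (hf : RegularAt K f x) (hg : RegularAt K g x) :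
    RegularAt K (fun y => f y * g y) x :=
  SpaceWithFunctions.mul hf hg

theorem RegularAt.inv {f : X → K} {x : X} (hf : RegularAt K f x) (h : f x ≠ 0) :
    RegularAt K (fun y => (f y)⁻¹) x :=
  SpaceWithFunctions.inv hf h

theorem RegularAt.sum {ι : Type*} {s : Finset ι} {f : ι → X → K} {x : X}
    (h : ∀ i ∈ s, RegularAt K (f i) x) : RegularAt K (fun y => ∑ i ∈ s, f i y) x := by
  classical
  induction s using Finset.induction_on with
  | empty => simpa using regularAt_const (0 : K) x
  | insert i s hi ih =>
    simp only [Finset.sum_insert hi]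
    exact (h i (Finset.mem_insert_self i s)).add
      (ih fun j hj => h j (Finset.mem_insert_of_mem hj))

theorem RegularAt.prod {ι : Type*} {s : Finset ι} {f : ι → X → K} {x : X}
    (h : ∀ i ∈ s, RegularAt K (f i) x) : RegularAt K (fun y => ∏ i ∈ s, f i y) x := by
  classical
  induction s using Finset.induction_on with
  | empty => simpa using regularAt_const (1 : K) x
  | insert i s hi ih =>
    simp only [Finset.prod_insert hi]
    exact (h i (Finset.mem_insert_self i s)).mul
      (ih fun j hj => h j (Finset.mem_insert_of_mem hj))

theorem RegularAt.det {ι : Type*} [Fintype ι] [DecidableEq ι] {M : X → Matrix ι ι K} {x : X}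
    (h : ∀ i j, RegularAt K (fun y => M y i j) x) : RegularAt K (fun y => (M y).det) x := by
  simp only [Matrix.det_apply']
  exact RegularAt.sum fun σ _ => (regularAt_const _ x).mul (RegularAt.prod fun i _ => h _ _)

/-- Cramer's rule: an entry of the inverse is the determinant of a matrix with one row replaced by a
constant row, divided by the determinant. -/
theorem RegularAt.matrix_inv {ι : Type*} [Fintype ι] [DecidableEq ι] {M : X → Matrix ι ι K} {x : X}
    (h : ∀ i j, RegularAt K (fun y => M y i j) x) (hx : (M x).det ≠ 0) (i j : ι) :
    RegularAt K (fun y => (M y)⁻¹ i j) x := by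
  simp only [Matrix.inv_def, Ring.inverse_eq_inv', Matrix.smul_apply, smul_eq_mul,
    Matrix.adjugate_apply]
  refine ((RegularAt.det h).inv hx).mul (RegularAt.det fun k l => ?_)
  by_cases hk : k = j
  · subst hk
    simpa using regularAt_const _ x
  · simpa [Matrix.updateRow_ne hk] using h k l

/-! ### Morphisms -/

theorem IsMorphism.regularAt {φ : X → Y} (hφ : IsMorphism K φ) {f : Y → K} {x : X}
    (hf : RegularAt K f (φ x)) : RegularAt K (fun y => f (φ y)) x :=
  hφ.2 x f hf

theorem IsMorphism.comp {ψ : Y → Z} {φ : X → Y} (hψ : IsMorphism K ψ) (hφ : IsMorphism K φ) :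
    IsMorphism K (fun x => ψ (φ x)) :=
  ⟨hψ.1.comp hφ.1, fun x f hf => hφ.2 x (fun y => f (ψ y)) (hψ.2 (φ x) f hf)⟩

theorem isMorphism_val {P : X → Prop} : IsMorphism K (Subtype.val : {x // P x} → X) :=
  ⟨continuous_subtype_val, fun _ f hf => ⟨f, hf, Eventually.of_forall fun _ => rfl⟩⟩

/-- Regular functions on the subspace extend locally to `Y`, so only functions on `Y` have to be
pulled back. -/
theorem IsMorphism.codRestrict {P : Y → Prop} {φ : X → {y // P y}}
    (h : IsMorphism K (fun x => (φ x).1)) : IsMorphism K φ := by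
  have hc : Continuous φ := continuous_induced_rng.2 h.1
  refine ⟨hc, ?_⟩
  rintro x f ⟨g, hg, hfg⟩
  exact (h.2 x g hg).congr ((hc.continuousAt.eventually hfg).mono fun _ h => h.symm)

/-- A neighbourhood in an open `U` is a neighbourhood in `X`, so the local extension provided by the
subspace structure agrees with `f` near `x`. -/
theorem RegularAt.of_isOpen {U : Set X} (hU : IsOpen U) {f : X → K} {x : U}
    (h : RegularAt K (fun y : U => f y) x) : RegularAt K f x := by
  obtain ⟨g, hg, h⟩ := h
  refine RegularAt.congr hg ?_
  have := hU.isOpenMap_subtype_val.image_mem_nhds h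
  filter_upwards [this]
  rintro _ ⟨y, hy, rfl⟩
  exact hy.symm

theorem isMorphism_of_forall_exists_isOpen {φ : X → Y}
    (h : ∀ x, ∃ U : Set X, IsOpen U ∧ x ∈ U ∧ IsMorphism K (fun y : U => φ y)) :
    IsMorphism K φ := by
  constructor
  · refine continuous_iff_continuousAt.2 fun x => ?_
    obtain ⟨U, hU, hx, h⟩ := h x
    exact (continuousOn_iff_continuous_domRestrict.2 h.1).continuousAt (hU.mem_nhds hx)
  · intro x f hf
    obtain ⟨U, hU, hx, h⟩ := h x
    exact RegularAt.of_isOpen hU (x := ⟨x, hx⟩) (h.2 ⟨x, hx⟩ f hf)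

end Regular

/-! ### Morphisms to affine spaces. -/

section Affine

variable {K : Type*} [Field K] {X : Type*} [TopologicalSpace X] [SpaceWithFunctions K X]
  {A B : Type*} [AddCommGroup A] [Module K A] [AddCommGroup B] [Module K B]

theorem regularAt_polyFun_comp {φ : X → A} {x : X}
    (h : ∀ l : Module.Dual K A, RegularAt K (fun y => l (φ y)) x) {p : A → K}
    (hp : p ∈ polyFun K A) : RegularAt K (fun y => p (φ y)) x := by
  induction hp using Algebra.adjoin_induction with
  | mem p hp => obtain ⟨l, rfl⟩ := hp; exact h l
  | algebraMap c => exact regularAt_const c x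
  | add p q _ _ hp hq => exact hp.add hq
  | mul p q _ _ hp hq => exact hp.mul hq

theorem dual_mem_polyFun (l : Module.Dual K A) : (fun a => l a) ∈ polyFun K A :=
  Algebra.subset_adjoin ⟨l, rfl⟩

theorem regularAt_of_mem_polyFun {p : A → K} (hp : p ∈ polyFun K A) (a : AffineSp K A) :
    RegularAt K (X := AffineSp K A) p a :=
  ⟨p, hp, 1, one_mem _, one_ne_zero, Eventually.of_forall fun _ => (div_one _).symm⟩

theorem regularAt_dual (l : Module.Dual K A) (a : AffineSp K A) :
    RegularAt K (X := AffineSp K A) (fun a => l a) a :=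
  regularAt_of_mem_polyFun (dual_mem_polyFun l) a

/-- Linear forms generate the polynomial functions, so they control everything. Continuity comes for
free: a basic open set `p ≠ 0` pulls back to the nonvanishing locus of a regular function, which is
open by the axioms. -/
theorem isMorphism_affine {φ : X → AffineSp K A}
    (h : ∀ (l : Module.Dual K A) (x : X), RegularAt K (fun y => l (φ y)) x) :
    IsMorphism K φ := by
  have hp : ∀ p ∈ polyFun K A, ∀ x, RegularAt K (fun y => p (φ y)) x :=
    fun p hp x => regularAt_polyFun_comp (fun l => h l x) hp
  have hc : Continuous φ := by
    refine ⟨fun U hU => isOpen_iff_mem_nhds.2 fun x hx => ?_⟩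
    obtain ⟨p, hpA, hpx, hpU⟩ := hU _ hx
    filter_upwards [SpaceWithFunctions.ne_zero (hp p hpA x) hpx] with y hy
    exact hpU _ hy
  refine ⟨hc, ?_⟩
  rintro x f ⟨p, hpA, q, hqA, hq, hf⟩
  refine ((hp p hpA x).mul ((hp q hqA x).inv hq)).congr ?_
  filter_upwards [hc.continuousAt.eventually hf] with y hy
  rw [hy, div_eq_mul_inv]

theorem IsMorphism.dual {φ : X → AffineSp K A} (h : IsMorphism K φ) (l : Module.Dual K A) (x : X) :
    RegularAt K (fun y => l (φ y)) x :=
  h.regularAt (regularAt_dual l (φ x))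

theorem isMorphism_linearMap (f : A →ₗ[K] B) :
    IsMorphism K (X := AffineSp K A) (Y := AffineSp K B) f :=
  isMorphism_affine fun l x => regularAt_dual (l ∘ₗ f) x

theorem isOpen_polyFun_ne_zero {p : A → K} (hp : p ∈ polyFun K A) :
    IsOpen {a : AffineSp K A | p a ≠ 0} :=
  fun _ ha => ⟨p, hp, ha, fun _ h => h⟩

end Affine

/-! ### The universal property of the product. -/

section Prod

variable {K : Type*} [Field K] {X Y Z : Type*}
  [TopologicalSpace X] [SpaceWithFunctions K X] [TopologicalSpace Y] [SpaceWithFunctions K Y]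
  [TopologicalSpace Z] [SpaceWithFunctions K Z]

theorem isMorphism_fst : IsMorphism K (ProdSp.fst : ProdSp K X Y → X) := by
  constructor
  · refine ⟨fun U hU z hz => ⟨U, univ, hU, isOpen_univ, hz, mem_univ _, fun _ => 1,
      IsTensorOn.const _ _ _, one_ne_zero, fun w hw _ _ => hw⟩⟩
  · intro z f hf
    obtain ⟨U, hf, hU, hz⟩ := eventually_nhds_iff.1 (SpaceWithFunctions.eventually hf)
    refine ⟨U, univ, hU, isOpen_univ, hz, mem_univ _, fun w => f w.fst, fun _ => 1,
      ⟨Unit, inferInstance, fun _ => f, fun _ _ => 1, fun _ => hf,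
        fun _ _ _ => regularAt_const 1 _, fun _ _ _ _ => by simp⟩,
      IsTensorOn.const _ _ _, one_ne_zero, Eventually.of_forall fun _ => (div_one _).symm⟩

theorem isMorphism_snd : IsMorphism K (ProdSp.snd : ProdSp K X Y → Y) := by
  constructor
  · refine ⟨fun V hV z hz => ⟨univ, V, isOpen_univ, hV, mem_univ _, hz, fun _ => 1,
      IsTensorOn.const _ _ _, one_ne_zero, fun w _ hw _ => hw⟩⟩
  · intro z f hf
    obtain ⟨V, hf, hV, hz⟩ := eventually_nhds_iff.1 (SpaceWithFunctions.eventually hf)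
    refine ⟨univ, V, isOpen_univ, hV, mem_univ _, hz, fun w => f w.snd, fun _ => 1,
      ⟨Unit, inferInstance, fun _ _ => 1, fun _ => f, fun _ _ _ => regularAt_const 1 _, fun _ => hf,
        fun _ _ _ _ => by simp⟩,
      IsTensorOn.const _ _ _, one_ne_zero, Eventually.of_forall fun _ => (div_one _).symm⟩

/-- Continuity is not automatic, the topology being finer than the product topology. It follows,
like regularity, from `key`: sums `∑ f k * g k` pull back to regular functions. -/
theorem isMorphism_prodMk {φ : X → Y} {ψ : X → Z} (hφ : IsMorphism K φ) (hψ : IsMorphism K ψ) :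
    IsMorphism K (fun x => (⟨φ x, ψ x⟩ : ProdSp K Y Z)) := by
  have key : ∀ {U : Set Y} {V : Set Z} {h : ProdSp K Y Z → K}, IsTensorOn U V h → IsOpen U →
      IsOpen V → ∀ x, φ x ∈ U → ψ x ∈ V → RegularAt K (fun x => h ⟨φ x, ψ x⟩) x := by
    rintro U V h ⟨ι, _, f, g, hf, hg, e⟩ hU hV x hx hx'
    refine (RegularAt.sum (s := Finset.univ) (f := fun k x => f k (φ x) * g k (ψ x))
      fun k _ => (hφ.regularAt (hf k _ hx)).mul (hψ.regularAt (hg k _ hx'))).congr ?_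
    filter_upwards [hφ.1.continuousAt.preimage_mem_nhds (hU.mem_nhds hx),
      hψ.1.continuousAt.preimage_mem_nhds (hV.mem_nhds hx')] with y h1 h2
    exact (e _ h1 _ h2).symm
  have hc : Continuous (fun x => (⟨φ x, ψ x⟩ : ProdSp K Y Z)) := by
    refine ⟨fun W hW => isOpen_iff_mem_nhds.2 fun x hx => ?_⟩
    obtain ⟨U, V, hU, hV, hxU, hxV, h, H, hx0, hw⟩ := hW _ hx
    filter_upwards [SpaceWithFunctions.ne_zero (key H hU hV x hxU hxV) hx0,
      hφ.1.continuousAt.preimage_mem_nhds (hU.mem_nhds hxU),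
      hψ.1.continuousAt.preimage_mem_nhds (hV.mem_nhds hxV)] with y h1 h2 h3
    exact hw _ h2 h3 h1
  refine ⟨hc, ?_⟩
  rintro x F ⟨U, V, hU, hV, hxU, hxV, p, q, hp, hq, hq0, h⟩
  refine ((key hp hU hV x hxU hxV).mul ((key hq hU hV x hxU hxV).inv hq0)).congr ?_
  filter_upwards [hc.continuousAt.eventually h] with y hy
  rw [hy, div_eq_mul_inv]

end Prod

/-! ### The space of frames. -/

section Frames

variable {K : Type*} [Field K] {W : Type*} [AddCommGroup W] [Module K W] {n : ℕ}

theorem isMorphism_frameSpan : IsMorphism K (frameSpan K W n) :=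
  ⟨continuous_coinduced_rng, fun x _ hf => hf.self_of_nhds x rfl⟩

theorem frameSpan_surjective [FiniteDimensional K W] :
    Function.Surjective (frameSpan K W n) := by
  rintro ⟨L, hL⟩
  let b := Module.finBasisOfFinrankEq K L hL
  refine ⟨⟨fun i => (b i : W), b.linearIndependent.map' L.subtype L.ker_subtype⟩,
    Subtype.ext ?_⟩
  have h := congrArg (Submodule.map L.subtype) b.span_eq
  rw [Submodule.map_span, ← Set.range_comp, Submodule.map_subtype_top] at h
  exact h

theorem regularAt_frames (k : Fin n) (l : Module.Dual K W) (w : Frames K W n) :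
    RegularAt K (fun w : Frames K W n => l ((w.1 : Fin n → W) k)) w :=
  isMorphism_val.regularAt (regularAt_dual (A := Fin n → W)
    (l ∘ₗ LinearMap.proj (R := K) (φ := fun _ : Fin n => W) k) w.1)

/-- Take a left inverse `g` of the map `c ↦ ∑ c_i w_i`. The determinant of the coordinates of `g (v
i)` is regular in `v`, equals 1 at `w`, and forces `v` to be independent where it does not vanish.
-/
theorem isOpen_frames : IsOpen (Frames K W n) := by
  refine isOpen_iff_mem_nhds.2 fun (w : Fin n → W) hw => ?_
  have hw : LinearIndependent K w := hw
  obtain ⟨g, hg⟩ := LinearMap.exists_leftInverse_of_injective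
    (Fintype.linearCombination K w) (LinearMap.ker_eq_bot.2 hw.fintypeLinearCombination_injective)
  have hr : RegularAt K (fun v : AffineSp K (Fin n → W) =>
      (Matrix.of fun i j => g ((v : Fin n → W) i) j).det) w :=
    RegularAt.det fun i j => regularAt_dual (A := Fin n → W)
      (LinearMap.proj (R := K) (φ := fun _ : Fin n => K) j ∘ₗ g ∘ₗ
        LinearMap.proj (R := K) (φ := fun _ : Fin n => W) i) w
  have h1 : (Matrix.of fun i j => g (w i) j) = 1 := by
    ext i j
    have := congrFun (LinearMap.congr_fun hg (Pi.single i 1)) j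
    rw [LinearMap.comp_apply, Fintype.linearCombination_apply_single, one_smul] at this
    rw [Matrix.of_apply, this, Matrix.one_apply, LinearMap.id_apply, Pi.single_apply]
    simp only [eq_comm]
  filter_upwards [SpaceWithFunctions.ne_zero hr (by rw [h1, Matrix.det_one]; exact one_ne_zero)]
    with v hv
  exact LinearIndependent.of_comp g (Matrix.linearIndependent_rows_of_det_ne_zero hv)

end Frames

/-! ### Affine charts of the Grassmannian by graphs. -/

section Charts

variable {K : Type*} [Field K] {W : Type*} [AddCommGroup W] [Module K W]
  {A C : Type*} [AddCommGroup A] [Module K A] [AddCommGroup C] [Module K C]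

/-- The graph of `h : A → C`, as a subspace of `W ≃ A × C`. -/
def chartSub (e : W ≃ₗ[K] A × C) (h : A →ₗ[K] C) : Submodule K W :=
  h.graph.comap e.toLinearMap

theorem mem_chartSub {e : W ≃ₗ[K] A × C} {h : A →ₗ[K] C} {x : W} :
    x ∈ chartSub e h ↔ (e x).2 = h (e x).1 :=
  LinearMap.mem_graph_iff _ _

/-- The graph of `h` is isomorphic to the source of `h`. -/
def chartSubEquiv (e : W ≃ₗ[K] A × C) (h : A →ₗ[K] C) : A ≃ₗ[K] chartSub e h where
  toFun a := ⟨e.symm (a, h a), by simp [mem_chartSub]⟩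
  map_add' a b := Subtype.ext (by
    change e.symm (a + b, h (a + b)) = e.symm (a, h a) + e.symm (b, h b)
    rw [map_add h, ← Prod.mk_add_mk, map_add])
  map_smul' c a := Subtype.ext (by
    change e.symm (c • a, h (c • a)) = c • e.symm (a, h a)
    rw [map_smul h, ← Prod.smul_mk, map_smul])
  invFun x := (e x).1
  left_inv a := by simp
  right_inv x := Subtype.ext (by
    have h1 := mem_chartSub.1 x.2
    exact e.symm_apply_eq.2 (Prod.ext rfl h1.symm))

theorem finrank_chartSub (e : W ≃ₗ[K] A × C) (h : A →ₗ[K] C) :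
    Module.finrank K (chartSub e h) = Module.finrank K A :=
  (chartSubEquiv e h).finrank_eq.symm

theorem chartSub_injective (e : W ≃ₗ[K] A × C) : Function.Injective (chartSub e) := by
  intro h h' hh
  ext a
  have : e.symm (a, h a) ∈ chartSub e h' := hh ▸ (chartSubEquiv e h a).2
  simpa [mem_chartSub] using this

open Classical in
/-- The linear map whose graph is a given subspace, if there is one. -/
noncomputable def chartCoord (e : W ≃ₗ[K] A × C) (L : Submodule K W) : A →ₗ[K] C :=
  if H : ∃ h : A →ₗ[K] C, chartSub e h = L then H.choose else 0

theorem chartCoord_chartSub (e : W ≃ₗ[K] A × C) (h : A →ₗ[K] C) :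
    chartCoord e (chartSub e h) = h := by
  have H : ∃ h' : A →ₗ[K] C, chartSub e h' = chartSub e h := ⟨h, rfl⟩
  rw [chartCoord, dif_pos H]
  exact chartSub_injective e H.choose_spec

variable {n : ℕ}

/-- The chart of the Grassmannian defined by a decomposition `W ≃ A × C`. -/
def chartMap (e : W ≃ₗ[K] A × C) (hA : Module.finrank K A = n) (h : A →ₗ[K] C) : Gr K W n :=
  ⟨chartSub e h, (finrank_chartSub e h).trans hA⟩

/-- The set of subspaces that are graphs of maps `A → C`. -/
def chartDom (e : W ≃ₗ[K] A × C) (n : ℕ) : Set (Gr K W n) :=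
  {L | ∀ x ∈ L.1, (e x).1 = 0 → x = 0}

theorem chartMap_mem_chartDom (e : W ≃ₗ[K] A × C) (hA : Module.finrank K A = n)
    (h : A →ₗ[K] C) : chartMap e hA h ∈ chartDom e n := by
  intro x hx hx0
  have := mem_chartSub.1 hx
  rw [hx0, map_zero] at this
  exact e.map_eq_zero_iff.1 (Prod.ext hx0 this)

/-- The chart lifts to frames: the graph of `h` is spanned by the vectors `(b k, h (b k))`, which
depend on `h` in an affine-linear way. -/
theorem isMorphism_chartMap [FiniteDimensional K A] (e : W ≃ₗ[K] A × C)
    (hA : Module.finrank K A = n) :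
    IsMorphism K (X := AffineSp K (A →ₗ[K] C)) (chartMap e hA) := by
  let b := Module.finBasisOfFinrankEq K A hA
  have hb : ∀ h : A →ₗ[K] C, LinearIndependent K fun k => e.symm (b k, h (b k)) := by
    intro h
    refine LinearIndependent.of_comp (LinearMap.fst K A C ∘ₗ e.toLinearMap) ?_
    convert b.linearIndependent using 1
    ext k
    simp
  let w : (A →ₗ[K] C) → Frames K W n := fun h => ⟨fun k => e.symm (b k, h (b k)), hb h⟩
  have hw : IsMorphism K (X := AffineSp K (A →ₗ[K] C)) w := by
    refine IsMorphism.codRestrict (isMorphism_affine (A := Fin n → W) fun l h => ?_)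
    -- A linear form evaluated on the frame is a constant, from the `A`-components, plus a linear
    -- form in `h`.
    have h1 : ∀ h : A →ₗ[K] C, l (fun k => e.symm (b k, h (b k))) =
        l (fun k => e.symm (b k, 0)) +
        (l ∘ₗ LinearMap.pi fun k => e.symm.toLinearMap ∘ₗ LinearMap.inr K A C ∘ₗ
          LinearMap.applyₗ (b k)) h := by
      intro h
      rw [LinearMap.comp_apply, ← map_add]
      congr 1
      ext k
      simp [← map_add]
    exact ((regularAt_const _ _).add (regularAt_dual _ _)).congr
      (Eventually.of_forall fun h => (h1 h).symm)
  have h2 : ∀ h, frameSpan K W n (w h) = chartMap e hA h := by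
    intro h
    have : FiniteDimensional K (chartMap e hA h).1 := Module.Finite.equiv (chartSubEquiv e h)
    refine Subtype.ext (Submodule.eq_of_le_of_finrank_eq (Submodule.span_le.2 ?_)
      ((frameSpan K W n (w h)).2.trans (chartMap e hA h).2.symm))
    rintro _ ⟨k, rfl⟩
    exact (chartSubEquiv e h (b k)).2
  exact (funext h2 : (fun h => frameSpan K W n (w h)) = chartMap e hA) ▸
    isMorphism_frameSpan.comp hw

/-- The matrix of the first components of a family of vectors of `W ≃ A × C`. -/
noncomputable def frameMatrix (e : W ≃ₗ[K] A × C) (b : Module.Basis (Fin n) K A) (w : Fin n → W) :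
    Matrix (Fin n) (Fin n) K :=
  Matrix.of fun k j => b.repr (e (w k)).1 j

/-- The row vector `c` times the matrix gives the `A`-coordinates of `∑ c_k w_k`, so the left kernel
of the matrix is the intersection of the span with `C`. -/
theorem frameSpan_mem_chartDom_iff (e : W ≃ₗ[K] A × C) (b : Module.Basis (Fin n) K A)
    (w : Frames K W n) : frameSpan K W n w ∈ chartDom e n ↔ (frameMatrix e b w.1).det ≠ 0 := by
  obtain ⟨(w : Fin n → W), hw⟩ := w
  have hw : LinearIndependent K w := hw
  have key : ∀ (c : Fin n → K) j,
      Matrix.vecMul c (frameMatrix e b w) j = b.repr (e (∑ k, c k • w k)).1 j := by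
    intro c j
    simp [frameMatrix, Matrix.vecMul, dotProduct, Prod.fst_sum]
  constructor
  · intro h h0
    obtain ⟨c, hc, hc0⟩ := Matrix.exists_vecMul_eq_zero_iff.2 h0
    have h1 := h (∑ k, c k • w k) (Submodule.sum_mem _ fun k _ =>
      Submodule.smul_mem _ _ (Submodule.subset_span ⟨k, rfl⟩)) (b.repr.map_eq_zero_iff.1 (by
        ext j
        rw [← key, hc0]
        rfl))
    exact hc (funext (Fintype.linearIndependent_iff.1 hw c h1))
  · intro h x hx hx0
    obtain ⟨c, rfl⟩ := (Submodule.mem_span_range_iff_exists_fun K).1 hx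
    have hc : c = 0 := Matrix.eq_zero_of_vecMul_eq_zero h (funext fun j => by
      rw [key, hx0]
      simp)
    simp [hc]

/-- The linear map whose graph is spanned by a given family of vectors. -/
noncomputable def frameCoord (e : W ≃ₗ[K] A × C) (b : Module.Basis (Fin n) K A) (w : Fin n → W) :
    A →ₗ[K] C :=
  ∑ j, ∑ k, (frameMatrix e b w)⁻¹ j k • (b.coord j).smulRight (e (w k)).2

/-- Multiplying by the inverse matrix makes `frameCoord` send the `A`-component of each `w k` to its
`C`-component. The span is then contained in the graph, and the dimensions agree. -/
theorem chartSub_frameCoord (e : W ≃ₗ[K] A × C) (b : Module.Basis (Fin n) K A)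
    (w : Frames K W n) (h : (frameMatrix e b w.1).det ≠ 0) :
    chartSub e (frameCoord e b w.1) = (frameSpan K W n w).1 := by
  have hA : Module.finrank K A = n := by simpa using Module.finrank_eq_card_basis b
  have : FiniteDimensional K A := b.finiteDimensional_of_finite
  have : FiniteDimensional K (chartSub e (frameCoord e b w.1)) :=
    Module.Finite.equiv (chartSubEquiv _ _)
  refine (Submodule.eq_of_le_of_finrank_eq ?_
    ((frameSpan K W n w).2.trans ((finrank_chartSub e _).trans hA).symm)).symm
  refine Submodule.span_le.2 ?_
  obtain ⟨(w : Fin n → W), hw⟩ := w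
  rintro _ ⟨k, rfl⟩
  refine mem_chartSub.2 ?_
  have h1 := Matrix.mul_nonsing_inv _ (isUnit_iff_ne_zero.2 h)
  obtain ⟨N, hN⟩ : ∃ N : Fin n → Fin n → K, ∀ j k, (frameMatrix e b w)⁻¹ j k = N j k :=
    ⟨fun j k => (frameMatrix e b w)⁻¹ j k, fun _ _ => rfl⟩
  have h2 : ∀ l, ∑ j, N j l * b.repr (e (w k)).1 j = if k = l then 1 else 0 := by
    intro l
    have := congrFun (congrFun h1 k) l
    rw [Matrix.mul_apply, Matrix.one_apply] at this
    rw [← this]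
    exact Finset.sum_congr rfl fun j _ => by rw [← hN, mul_comm]; rfl
  have h3 : frameCoord e b w = ∑ j, ∑ k, N j k • (b.coord j).smulRight (e (w k)).2 :=
    Finset.sum_congr rfl fun j _ => Finset.sum_congr rfl fun k _ => by rw [hN]
  change (e (w k)).2 = frameCoord e b w (e (w k)).1
  simp only [h3, LinearMap.sum_apply, LinearMap.smul_apply, LinearMap.smulRight_apply,
    Module.Basis.coord_apply]
  rw [Finset.sum_comm]
  simp only [smul_smul, ← Finset.sum_smul, h2]
  simp

theorem isOpen_chartDom [FiniteDimensional K A] (e : W ≃ₗ[K] A × C)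
    (hA : Module.finrank K A = n) : IsOpen (chartDom e n) := by
  let b := Module.finBasisOfFinrankEq K A hA
  refine isOpen_coinduced.2 (isOpen_iff_mem_nhds.2 fun w hw => ?_)
  have hr : RegularAt K (fun w : Frames K W n => (frameMatrix e b w.1).det) w :=
    RegularAt.det fun k j =>
      regularAt_frames k (b.coord j ∘ₗ LinearMap.fst K A C ∘ₗ e.toLinearMap) w
  filter_upwards [SpaceWithFunctions.ne_zero hr ((frameSpan_mem_chartDom_iff e b w).1 hw)]
    with w hw
  exact (frameSpan_mem_chartDom_iff e b w).2 hw

theorem chartSub_chartCoord [FiniteDimensional K W] (e : W ≃ₗ[K] A × C)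
    (hA : Module.finrank K A = n) {L : Gr K W n} (hL : L ∈ chartDom e n) :
    chartSub e (chartCoord e L.1) = L.1 := by
  have : FiniteDimensional K A :=
    Module.Finite.of_surjective (LinearMap.fst K A C ∘ₗ e.toLinearMap)
      ((LinearMap.fst_surjective (R := K) (M := A) (M₂ := C)).comp e.surjective)
  let b := Module.finBasisOfFinrankEq K A hA
  obtain ⟨w, rfl⟩ := frameSpan_surjective L
  rw [← chartSub_frameCoord e b w ((frameSpan_mem_chartDom_iff e b w).1 hL), chartCoord_chartSub]

/-- Regularity on the Grassmannian is tested on frames, where the coordinate is given by the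
explicit formula `frameCoord`, built from the entries of the frame and of an inverse matrix. -/
theorem isMorphism_chartCoord [FiniteDimensional K A] (e : W ≃ₗ[K] A × C)
    (hA : Module.finrank K A = n) :
    IsMorphism K (Y := AffineSp K (A →ₗ[K] C)) (fun L : chartDom e n => chartCoord e L.1.1) := by
  let b := Module.finBasisOfFinrankEq K A hA
  refine isMorphism_affine fun l L => isMorphism_val.regularAt (f := fun L : Gr K W n =>
    l (chartCoord e L.1)) ?_
  filter_upwards [(isOpen_chartDom e hA).mem_nhds L.2]
  rintro _ hw w rfl
  have hd := (frameSpan_mem_chartDom_iff e b w).1 hw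
  have h1 : RegularAt K (fun w : Frames K W n => l (frameCoord e b w.1)) w := by
    simp only [frameCoord, map_sum, map_smul, smul_eq_mul]
    refine RegularAt.sum fun j _ => RegularAt.sum fun k _ =>
      (RegularAt.matrix_inv (M := fun w : Frames K W n => frameMatrix e b w.1)
        (fun k j => ?_) hd _ _).mul ?_
    · exact regularAt_frames k (b.coord j ∘ₗ LinearMap.fst K A C ∘ₗ e.toLinearMap) w
    · exact regularAt_frames k
        (l ∘ₗ LinearMap.smulRightₗ (b.coord j) ∘ₗ LinearMap.snd K A C ∘ₗ e.toLinearMap) w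
  -- The formula is valid only for frames spanning a subspace in the chart domain; this domain is
  -- open, so that is enough.
  refine h1.congr ?_
  filter_upwards [((isOpen_chartDom e hA).preimage isMorphism_frameSpan.1).mem_nhds hw] with v hv
  rw [← chartSub_frameCoord e b v ((frameSpan_mem_chartDom_iff e b v).1 hv), chartCoord_chartSub]

end Charts

/-! ### Subspaces of `V ⊕ εV` as triples `(F, G, φ)`. -/

section HomSubmodule

variable {K : Type*} [Field K] {V : Type*} [AddCommGroup V] [Module K V]

theorem mem_homSubmodule {F G : Submodule K V} {φ : F →ₗ[K] V ⧸ G} {x : V × V} :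
    x ∈ homSubmodule F G φ ↔ ∃ h : x.1 ∈ F, φ ⟨x.1, h⟩ = G.mkQ x.2 :=
  Iff.rfl

theorem mem_piPart {L : Submodule K (V × V)} {v : V} : v ∈ piPart L ↔ ∃ w, (v, w) ∈ L := by
  constructor
  · rintro ⟨⟨v, w⟩, h, rfl⟩
    exact ⟨w, h⟩
  · rintro ⟨w, h⟩
    exact ⟨(v, w), h, rfl⟩

theorem mem_epsPart {L : Submodule K (V × V)} {w : V} : w ∈ epsPart L ↔ (0, w) ∈ L :=
  Iff.rfl

/-- Stability under `ε` is a condition on `F` and `G` alone, so `φ` is unconstrained: this is why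
the fibre is all of `Hom(F, V/G)`. -/
theorem map_epsMul_le_iff {L : Submodule K (V × V)} :
    L.map (epsMul K V) ≤ L ↔ piPart L ≤ epsPart L := by
  refine ⟨piPart_le_epsPart, ?_⟩
  rintro h _ ⟨⟨v, w⟩, hx, rfl⟩
  exact h (mem_piPart.2 ⟨w, hx⟩)

theorem piPart_homSubmodule (F G : Submodule K V) (φ : F →ₗ[K] V ⧸ G) :
    piPart (homSubmodule F G φ) = F := by
  ext v
  refine mem_piPart.trans ⟨fun ⟨w, h, _⟩ => h, fun h => ?_⟩
  obtain ⟨w, hw⟩ := G.mkQ_surjective (φ ⟨v, h⟩)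
  exact ⟨w, h, hw.symm⟩

theorem epsPart_homSubmodule (F G : Submodule K V) (φ : F →ₗ[K] V ⧸ G) :
    epsPart (homSubmodule F G φ) = G := by
  ext w
  refine mem_epsPart.trans ⟨fun ⟨h, e⟩ => ?_, fun h => ⟨F.zero_mem, ?_⟩⟩
  · have h0 : φ ⟨0, h⟩ = 0 := map_zero φ
    exact (Submodule.Quotient.mk_eq_zero G).1 (e.symm.trans h0)
  · exact (map_zero φ).trans ((Submodule.Quotient.mk_eq_zero G).2 h).symm

theorem homSubmodule_injective (F G : Submodule K V) : Function.Injective (homSubmodule F G) := by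
  intro φ ψ h
  ext v
  obtain ⟨w, hw⟩ := G.mkQ_surjective (φ v)
  have hv : ((v : V), w) ∈ homSubmodule F G ψ := h ▸ (⟨v.2, hw.symm⟩ : _ ∈ homSubmodule F G φ)
  obtain ⟨_, h2⟩ := hv
  exact hw.symm.trans h2.symm

/-- Choose a linear section `s` of `L → F` and let `φ v` be the class mod `G` of the `ε`-component
of `s v`. A pair `(v, w)` lies in `L` if and only if its difference with `s v`, which lies in `εV`,
belongs to `εG`. -/
theorem exists_homSubmodule_eq (L : Submodule K (V × V)) :
    ∃ φ, homSubmodule (piPart L) (epsPart L) φ = L := by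
  let p : L →ₗ[K] piPart L := LinearMap.restrict (LinearMap.fst K V V)
    fun x hx => Submodule.mem_map_of_mem hx
  have hp : LinearMap.range p = ⊤ := by
    refine LinearMap.range_eq_top.2 ?_
    rintro ⟨v, hv⟩
    obtain ⟨w, hw⟩ := mem_piPart.1 hv
    exact ⟨⟨(v, w), hw⟩, rfl⟩
  obtain ⟨s, hs⟩ := p.exists_rightInverse_of_surjective hp
  have hs' : ∀ v, (s v).1.1 = v := fun v => congrArg Subtype.val (LinearMap.congr_fun hs v)
  refine ⟨(epsPart L).mkQ ∘ₗ LinearMap.snd K V V ∘ₗ L.subtype ∘ₗ s, ?_⟩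
  have key : ∀ (v : piPart L) (w : V), ((v : V), w) ∈ L ↔ (s v).1.2 - w ∈ epsPart L := by
    intro v w
    rw [mem_epsPart, ← Submodule.sub_mem_iff_right L (s v).2]
    have : (s v : V × V) - ((v : V), w) = (0, (s v).1.2 - w) := Prod.ext (by simp [hs']) rfl
    rw [this]
  ext ⟨v, w⟩
  constructor
  · rintro ⟨h, e⟩
    exact (key ⟨v, h⟩ w).2 ((Submodule.Quotient.eq _).1 e)
  · intro h
    have hv : v ∈ piPart L := mem_piPart.2 ⟨w, h⟩
    exact ⟨hv, (Submodule.Quotient.eq _).2 ((key ⟨v, hv⟩ w).1 h)⟩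

theorem flagVar_ext {i j : ℕ} {b c : FlagVar K V i j} (h1 : b.1.fst.1 = c.1.fst.1)
    (h2 : b.1.snd.1 = c.1.snd.1) : b = c := by
  obtain ⟨⟨⟨F, hF⟩, ⟨G, hG⟩⟩, hb⟩ := b
  obtain ⟨⟨⟨F', hF'⟩, ⟨G', hG'⟩⟩, hc⟩ := c
  obtain rfl : F = F' := h1
  obtain rfl : G = G' := h2
  rfl

variable [FiniteDimensional K V] {n i : ℕ}

/-- A point of a stratum, given by a subspace and its flag. -/
def stratumMk (hi : i ≤ n) (b : FlagVar K V i (n - i)) (L : Submodule K (V × V))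
    (h1 : piPart L = b.1.fst.1) (h2 : epsPart L = b.1.snd.1) : stratum K V n i :=
  ⟨⟨⟨L, by
    have h := finrank_piPart_add_finrank_epsPart L
    rw [h1, h2, b.1.fst.2, b.1.snd.2] at h
    omega⟩, map_epsMul_le_iff.2 (h1.trans_le (b.2.trans_eq h2.symm))⟩,
    (congrArg (fun F : Submodule K V => Module.finrank K F) h1).trans b.1.fst.2⟩

theorem flagOf_stratumMk (hi : i ≤ n) (b : FlagVar K V i (n - i)) (L : Submodule K (V × V))
    (h1 : piPart L = b.1.fst.1) (h2 : epsPart L = b.1.snd.1) :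
    flagOf (stratumMk hi b L h1 h2) = b :=
  flagVar_ext h1 h2

/-- The fibre of a stratum over a flag `F ⊆ G` is `Hom(F, V / G)`. -/
noncomputable def fiberEquiv (hi : i ≤ n) (b : FlagVar K V i (n - i)) :
    (b.1.fst.1 →ₗ[K] V ⧸ b.1.snd.1) ≃ {L : stratum K V n i // flagOf L = b} :=
  Equiv.ofBijective
    (fun φ => ⟨stratumMk hi b (homSubmodule b.1.fst.1 b.1.snd.1 φ)
      (piPart_homSubmodule _ _ φ) (epsPart_homSubmodule _ _ φ), flagOf_stratumMk _ _ _ _ _⟩) (by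
    constructor
    · intro φ ψ h
      exact homSubmodule_injective _ _ (congrArg (fun L => L.1.1.1.1) h)
    · rintro ⟨L, rfl⟩
      obtain ⟨φ, hφ⟩ := exists_homSubmodule_eq L.1.1.1
      exact ⟨φ, Subtype.ext (Subtype.ext (Subtype.ext (Subtype.ext hφ)))⟩)

end HomSubmodule

/-! ### Simultaneous graph coordinates for `F`, `G`, `φ` and `L`. -/

section FlagCharts

variable {K : Type*} [Field K] {V : Type*} [AddCommGroup V] [Module K V]
  {A M C : Type*} [AddCommGroup A] [Module K A] [AddCommGroup M] [Module K M]
  [AddCommGroup C] [Module K C]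

/-- The decomposition `V ≃ (A × M) × C` deduced from `V ≃ A × M × C`. -/
def bigDecomp (e : V ≃ₗ[K] A × M × C) : V ≃ₗ[K] (A × M) × C :=
  e.trans (LinearEquiv.prodAssoc K A M C).symm

theorem bigDecomp_apply (e : V ≃ₗ[K] A × M × C) (v : V) :
    bigDecomp e v = (((e v).1, (e v).2.1), (e v).2.2) :=
  rfl

/-- The decomposition of `V ⊕ εV` deduced from `V ≃ A × M × C`. -/
def sumDecomp (e : V ≃ₗ[K] A × M × C) : (V × V) ≃ₗ[K] (A × (A × M)) × ((M × C) × C) :=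
  (e.prodCongr (bigDecomp e)).trans (LinearEquiv.prodProdProdComm K A (M × C) (A × M) C)

theorem sumDecomp_apply (e : V ≃ₗ[K] A × M × C) (x : V × V) :
    sumDecomp e x = (((e x.1).1, (bigDecomp e x.2).1), ((e x.1).2, (bigDecomp e x.2).2)) :=
  rfl

variable (K A M C) in
/-- The coordinate of `L` in terms of the coordinates of `F`, of `G` and of `φ : F → V / G`. -/
def assembleHom : ((A →ₗ[K] M × C) × (A × M →ₗ[K] C) × (A →ₗ[K] C)) →ₗ[K]
    (A × (A × M) →ₗ[K] (M × C) × C) where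
  toFun p := (p.1 ∘ₗ LinearMap.fst K A (A × M)).prod
    (p.2.2 ∘ₗ LinearMap.fst K A (A × M) + p.2.1 ∘ₗ LinearMap.snd K A (A × M))
  map_add' p q := by
    refine LinearMap.ext fun x => Prod.ext rfl ?_
    change (p.2.2 x.1 + q.2.2 x.1) + (p.2.1 x.2 + q.2.1 x.2) =
      (p.2.2 x.1 + p.2.1 x.2) + (q.2.2 x.1 + q.2.1 x.2)
    abel
  map_smul' c p := by
    refine LinearMap.ext fun x => Prod.ext rfl ?_
    exact (smul_add c (p.2.2 x.1) (p.2.1 x.2)).symm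

theorem assembleHom_apply (p : (A →ₗ[K] M × C) × (A × M →ₗ[K] C) × (A →ₗ[K] C))
    (x : A × (A × M)) : assembleHom K A M C p x = (p.1 x.1, p.2.2 x.1 + p.2.1 x.2) :=
  rfl

variable (K A M C) in
/-- The left inverse of `assembleHom`. -/
def splitHom : (A × (A × M) →ₗ[K] (M × C) × C) →ₗ[K]
    ((A →ₗ[K] M × C) × (A × M →ₗ[K] C) × (A →ₗ[K] C)) where
  toFun h := (LinearMap.fst K (M × C) C ∘ₗ h ∘ₗ LinearMap.inl K A (A × M),
    LinearMap.snd K (M × C) C ∘ₗ h ∘ₗ LinearMap.inr K A (A × M),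
    LinearMap.snd K (M × C) C ∘ₗ h ∘ₗ LinearMap.inl K A (A × M))
  map_add' _ _ := rfl
  map_smul' _ _ := rfl

theorem splitHom_assembleHom (p : (A →ₗ[K] M × C) × (A × M →ₗ[K] C) × (A →ₗ[K] C)) :
    splitHom K A M C (assembleHom K A M C p) = p := by
  refine Prod.ext rfl (Prod.ext (LinearMap.ext fun x => ?_) (LinearMap.ext fun x => ?_))
  · change p.2.2 0 + p.2.1 x = p.2.1 x
    rw [map_zero, zero_add]
  · change p.2.2 x + p.2.1 0 = p.2.2 x
    rw [map_zero, add_zero]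

theorem mem_chartSub_assembleHom {e : V ≃ₗ[K] A × M × C}
    {p : (A →ₗ[K] M × C) × (A × M →ₗ[K] C) × (A →ₗ[K] C)} {x : V × V} :
    x ∈ chartSub (sumDecomp e) (assembleHom K A M C p) ↔ (e x.1).2 = p.1 (e x.1).1 ∧
      (bigDecomp e x.2).2 = p.2.2 (e x.1).1 + p.2.1 (bigDecomp e x.2).1 :=
  mem_chartSub.trans Prod.ext_iff

theorem piPart_chartSub_assembleHom (e : V ≃ₗ[K] A × M × C)
    (p : (A →ₗ[K] M × C) × (A × M →ₗ[K] C) × (A →ₗ[K] C)) :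
    piPart (chartSub (sumDecomp e) (assembleHom K A M C p)) = chartSub e p.1 := by
  ext v
  refine mem_piPart.trans ⟨fun ⟨w, hw⟩ => mem_chartSub.2 (mem_chartSub_assembleHom.1 hw).1,
    fun h => ⟨(bigDecomp e).symm (0, p.2.2 (e v).1), mem_chartSub_assembleHom.2
      ⟨mem_chartSub.1 h, ?_⟩⟩⟩
  simp

theorem epsPart_chartSub_assembleHom (e : V ≃ₗ[K] A × M × C)
    (p : (A →ₗ[K] M × C) × (A × M →ₗ[K] C) × (A →ₗ[K] C)) :
    epsPart (chartSub (sumDecomp e) (assembleHom K A M C p)) = chartSub (bigDecomp e) p.2.1 := by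
  ext w
  refine mem_epsPart.trans (mem_chartSub_assembleHom.trans ?_)
  simp [mem_chartSub]

/-- The maps of the form `assembleHom p` are those whose block `A × M → M × C` vanishes. A value of
this block is the projection to `V` of a vector of the graph, hence lies in `F`, and it has zero
`A`-component; the hypothesis kills it. -/
theorem assembleHom_splitHom {e : V ≃ₗ[K] A × M × C} {h : A × (A × M) →ₗ[K] (M × C) × C}
    (hF : ∀ v ∈ piPart (chartSub (sumDecomp e) h), (e v).1 = 0 → v = 0) :
    assembleHom K A M C (splitHom K A M C h) = h := by
  have key : ∀ g : A × M, (h (0, g)).1 = 0 := by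
    intro g
    have h1 : e.symm (0, (h (0, g)).1) = 0 := by
      refine hF _ (mem_piPart.2 ⟨(bigDecomp e).symm (g, (h (0, g)).2), ?_⟩) (by simp)
      simp [mem_chartSub, sumDecomp_apply]
    simpa using h1
  refine LinearMap.ext fun x => ?_
  have hx : x = (x.1, 0) + (0, x.2) := by simp
  conv_rhs => rw [hx, map_add]
  rw [assembleHom_apply]
  refine Prod.ext ?_ rfl
  rw [Prod.fst_add, key, add_zero]
  rfl

/-- The summand `C` is complementary to the graph of `b`, so `C ≃ V/G`, while `A ≃ F` by the graph
of `a`. Conjugating by these two isomorphisms gives `ε`; its linearity is the linearity of the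
trivialization on fibres. -/
theorem homSubmodule_chartSub (e : V ≃ₗ[K] A × M × C) (a : A →ₗ[K] M × C) (b : A × M →ₗ[K] C) :
    ∃ ε : (A →ₗ[K] C) ≃ₗ[K] (chartSub e a →ₗ[K] V ⧸ chartSub (bigDecomp e) b), ∀ φ,
      homSubmodule (chartSub e a) (chartSub (bigDecomp e) b) (ε φ) =
        chartSub (sumDecomp e) (assembleHom K A M C (a, b, φ)) := by
  let q : C →ₗ[K] V ⧸ chartSub (bigDecomp e) b := (chartSub (bigDecomp e) b).mkQ ∘ₗ
    (bigDecomp e).symm.toLinearMap ∘ₗ LinearMap.inr K (A × M) C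
  have hq : ∀ c w, q c = (chartSub (bigDecomp e) b).mkQ w ↔
      (bigDecomp e w).2 = c + b (bigDecomp e w).1 := by
    intro c w
    refine (Submodule.Quotient.eq _).trans (mem_chartSub.trans ?_)
    change (bigDecomp e ((bigDecomp e).symm (0, c) - w)).2 =
      b (bigDecomp e ((bigDecomp e).symm (0, c) - w)).1 ↔ _
    rw [map_sub, LinearEquiv.apply_symm_apply, Prod.snd_sub, Prod.fst_sub, zero_sub, map_neg,
      sub_eq_iff_eq_add, neg_add_eq_sub, eq_sub_iff_add_eq, eq_comm]
  have hb : Function.Bijective q := by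
    constructor
    · intro c c' h
      have := (hq c ((bigDecomp e).symm (0, c'))).1 h
      simpa [eq_comm] using this
    · intro y
      obtain ⟨w, rfl⟩ := Submodule.mkQ_surjective _ y
      exact ⟨(bigDecomp e w).2 - b (bigDecomp e w).1, (hq _ _).2 (by simp)⟩
  refine ⟨(chartSubEquiv e a).arrowCongr (LinearEquiv.ofBijective q hb), fun φ => ?_⟩
  ext ⟨v, w⟩
  rw [mem_homSubmodule, mem_chartSub_assembleHom]
  constructor
  · rintro ⟨h, h'⟩
    exact ⟨mem_chartSub.1 h, (hq _ w).1 h'⟩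
  · rintro ⟨h, h'⟩
    exact ⟨mem_chartSub.2 h, (hq _ w).2 h'⟩

theorem exists_adapted_decomposition [FiniteDimensional K V] {F G : Submodule K V} (h : F ≤ G) :
    ∃ (M C : Submodule K V) (e : V ≃ₗ[K] F × M × C),
      (∀ x, x ∈ F ↔ (e x).2 = 0) ∧ ∀ x, x ∈ G ↔ (e x).2.2 = 0 := by
  obtain ⟨M', hM⟩ := F.exists_isCompl
  obtain ⟨C, hC⟩ := G.exists_isCompl
  -- By the modular law, intersecting a complement of `F` in `V` with `G` gives a complement of `F`
  -- in `G`.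
  have hG : F ⊔ M' ⊓ G = G := by
    rw [← sup_inf_assoc_of_le _ h, hM.sup_eq_top, top_inf_eq]
  let f : (F × ↥(M' ⊓ G) × C) →ₗ[K] V :=
    F.subtype.coprod ((M' ⊓ G).subtype.coprod C.subtype)
  have hf : ∀ x, f x = x.1 + (x.2.1 + x.2.2) := fun x => rfl
  have hGC : ∀ g ∈ G, ∀ c ∈ C, g + c = 0 → c = 0 := fun g hg c hc h =>
    hC.disjoint.le_bot ⟨by rw [eq_neg_of_add_eq_zero_right h]; exact G.neg_mem hg, hc⟩
  have hinj : Function.Injective f := by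
    refine (injective_iff_map_eq_zero f).2 ?_
    rintro ⟨x, m, c⟩ hx
    rw [hf] at hx
    have hc : (c : V) = 0 := hGC (x + m) (G.add_mem (h x.2) m.2.2) c c.2 (by
      rw [← hx]; exact add_assoc _ _ _)
    simp only [hc, add_zero] at hx
    have hm : (m : V) = 0 := hM.disjoint.le_bot
      ⟨by rw [eq_neg_of_add_eq_zero_right hx]; exact F.neg_mem x.2, m.2.1⟩
    rw [hm, add_zero] at hx
    exact Prod.ext (Subtype.ext hx) (Prod.ext (Subtype.ext hm) (Subtype.ext hc))
  have hsurj : Function.Surjective f := by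
    intro v
    obtain ⟨g, hg, c, hc, rfl⟩ := Submodule.mem_sup.1 (hC.sup_eq_top ▸ Submodule.mem_top (x := v))
    rw [← hG] at hg
    obtain ⟨x, hx, m, hm, rfl⟩ := Submodule.mem_sup.1 hg
    exact ⟨(⟨x, hx⟩, ⟨m, hm⟩, ⟨c, hc⟩), (add_assoc _ _ _).symm⟩
  let e := LinearEquiv.ofBijective f ⟨hinj, hsurj⟩
  have he : ∀ x, e x = x.1 + (x.2.1 + x.2.2) := hf
  refine ⟨_, C, e.symm, fun x => ?_, fun x => ?_⟩
  · obtain ⟨⟨x, m, c⟩, rfl⟩ := e.surjective x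
    rw [e.symm_apply_apply]
    constructor
    · intro hx
      have : e (x, m, c) = e (⟨_, hx⟩, 0, 0) := by
        rw [he (⟨_, hx⟩, 0, 0)]
        simp
      exact (congrArg Prod.snd (e.injective this) :)
    · intro hx
      obtain ⟨rfl, rfl⟩ := Prod.ext_iff.1 hx
      rw [he]
      simp
  · obtain ⟨⟨x, m, c⟩, rfl⟩ := e.surjective x
    rw [e.symm_apply_apply]
    constructor
    · intro hx
      have h1 : (x : V) + m ∈ G := G.add_mem (h x.2) m.2.2
      have h2 : (x : V) + m + c ∈ G := by rw [add_assoc]; exact hx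
      exact Subtype.ext (hC.disjoint.le_bot ⟨(G.add_mem_iff_right h1).1 h2, c.2⟩)
    · rintro rfl
      change (x : V) + (m + 0) ∈ G
      rw [add_zero]
      exact G.add_mem (h x.2) m.2.2

end FlagCharts

/-! ### The vector bundle structure of the strata. -/

section Bundle

variable {K : Type*} [Field K] {V : Type*} [AddCommGroup V] [Module K V] [FiniteDimensional K V]
  {A M C : Type*} [AddCommGroup A] [Module K A] [AddCommGroup M] [Module K M]
  [AddCommGroup C] [Module K C] [FiniteDimensional K A] [FiniteDimensional K M]
  {n i : ℕ}

/-- The flags `F ⊆ G` such that `F` is a graph over `A` and `G` is a graph over `A × M`. -/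
def flagDom (e : V ≃ₗ[K] A × M × C) (n i : ℕ) : Set (FlagVar K V i (n - i)) :=
  {b | b.1.fst ∈ chartDom e i ∧ b.1.snd ∈ chartDom (bigDecomp e) (n - i)}

theorem isOpen_flagDom (e : V ≃ₗ[K] A × M × C) (hA : Module.finrank K A = i)
    (hM : Module.finrank K (A × M) = n - i) : IsOpen (flagDom e n i) :=
  ((isOpen_chartDom e hA).preimage (isMorphism_fst.comp isMorphism_val).1).inter
    ((isOpen_chartDom (bigDecomp e) hM).preimage (isMorphism_snd.comp isMorphism_val).1)

theorem exists_mem_flagDom (b : FlagVar K V i (n - i)) :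
    ∃ (A M C : Submodule K V) (e : V ≃ₗ[K] A × M × C), Module.finrank K A = i ∧
      Module.finrank K (A × M) = n - i ∧ b ∈ flagDom e n i := by
  obtain ⟨M, C, e, hF, hG⟩ := exists_adapted_decomposition b.2
  refine ⟨_, M, C, e, b.1.fst.2, ?_, fun x hx hx0 => ?_, fun x hx hx0 => ?_⟩
  -- In a decomposition adapted to the flag itself, `G` is the graph of the zero map, which gives
  -- the dimension of `A × M`.
  · have h1 : chartSub (bigDecomp e) 0 = b.1.snd.1 := by
      ext x
      exact mem_chartSub.trans (hG x).symm
    rw [← finrank_chartSub (bigDecomp e) 0, h1]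
    exact b.1.snd.2
  · exact e.map_eq_zero_iff.1 (Prod.ext hx0 ((hF x).1 hx))
  · exact (bigDecomp e).map_eq_zero_iff.1 (Prod.ext hx0 ((hG x).1 hx))

theorem finrank_sumDecomp_source (hi : i ≤ n) (hA : Module.finrank K A = i)
    (hM : Module.finrank K (A × M) = n - i) : Module.finrank K (A × (A × M)) = n := by
  rw [Module.finrank_prod, hA, hM]
  omega

/-- The part of the stratum over a chart of the flag variety is thus cut out by a single
Grassmannian chart, where `L` has one coordinate containing those of `F`, `G` and `φ`. -/
theorem mem_chartDom_iff_flagOf_mem (e : V ≃ₗ[K] A × M × C)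
    (hM : Module.finrank K (A × M) = n - i) (L : stratum K V n i) :
    L.1.1 ∈ chartDom (sumDecomp e) n ↔ flagOf L ∈ flagDom e n i := by
  constructor
  · intro h
    have hG : (flagOf L).1.snd ∈ chartDom (bigDecomp e) (n - i) := by
      intro w hw hw0
      exact (Prod.ext_iff.1 (h (0, w) hw (Prod.ext (by simp [sumDecomp_apply]) hw0))).2
    refine ⟨fun v hv hv0 => ?_, hG⟩
    obtain ⟨w, hw⟩ := mem_piPart.1 hv
    have hb := chartSub_chartCoord (bigDecomp e) hM hG
    -- `g` is the element of `G` with the same `A × M`-component as `w`. Subtracting `εg` from `v +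
    -- εw` leaves a vector of `L` with zero coordinate in `A × (A × M)`, hence zero, so `v = 0`.
    let g := chartSubEquiv (bigDecomp e) (chartCoord (bigDecomp e) (flagOf L).1.snd.1)
      (bigDecomp e w).1
    have hg : (0, (g : V)) ∈ L.1.1.1 := hb.le g.2
    have hg1 : (bigDecomp e g).1 = (bigDecomp e w).1 := by
      simp [g, chartSubEquiv]
    have h1 := h _ (L.1.1.1.sub_mem hw hg) (by
      rw [sumDecomp_apply]
      refine Prod.ext ?_ ?_
      · simpa using hv0
      · simp [hg1])
    simpa using congrArg Prod.fst h1
  · rintro ⟨hF, hG⟩ ⟨v, w⟩ hx hx0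
    obtain rfl : v = 0 := hF v (mem_piPart.2 ⟨w, hx⟩) (congrArg Prod.fst hx0)
    obtain rfl : w = 0 := hG w hx (congrArg Prod.snd hx0)
    rfl

theorem isMorphism_stratum_val : IsMorphism K (fun L : stratum K V n i => L.1.1) :=
  IsMorphism.comp (K := K) (Y := SigmaVar K V n) isMorphism_val isMorphism_val

/-- The coordinates of a point of a stratum. -/
noncomputable def stratumCoord (e : V ≃ₗ[K] A × M × C) (L : stratum K V n i) :
    (A →ₗ[K] M × C) × (A × M →ₗ[K] C) × (A →ₗ[K] C) :=
  splitHom K A M C (chartCoord (sumDecomp e) L.1.1.1)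

theorem chartSub_stratumCoord (e : V ≃ₗ[K] A × M × C) (hi : i ≤ n) (hA : Module.finrank K A = i)
    (hM : Module.finrank K (A × M) = n - i) {L : stratum K V n i} (hL : flagOf L ∈ flagDom e n i) :
    chartSub (sumDecomp e) (assembleHom K A M C (stratumCoord e L)) = L.1.1.1 := by
  have h1 := chartSub_chartCoord (sumDecomp e) (finrank_sumDecomp_source hi hA hM)
    ((mem_chartDom_iff_flagOf_mem e hM L).2 hL)
  rw [stratumCoord, assembleHom_splitHom (e := e), h1]
  rw [h1]
  exact hL.1

theorem piPart_eq_chartSub (e : V ≃ₗ[K] A × M × C) (hi : i ≤ n) (hA : Module.finrank K A = i)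
    (hM : Module.finrank K (A × M) = n - i) {L : stratum K V n i} (hL : flagOf L ∈ flagDom e n i) :
    chartSub e (stratumCoord e L).1 = piPart L.1.1.1 := by
  rw [← piPart_chartSub_assembleHom, chartSub_stratumCoord e hi hA hM hL]

theorem epsPart_eq_chartSub (e : V ≃ₗ[K] A × M × C) (hi : i ≤ n) (hA : Module.finrank K A = i)
    (hM : Module.finrank K (A × M) = n - i) {L : stratum K V n i} (hL : flagOf L ∈ flagDom e n i) :
    chartSub (bigDecomp e) (stratumCoord e L).2.1 = epsPart L.1.1.1 := by
  rw [← epsPart_chartSub_assembleHom, chartSub_stratumCoord e hi hA hM hL]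

theorem isMorphism_stratumCoord (e : V ≃ₗ[K] A × M × C) (hi : i ≤ n)
    (hA : Module.finrank K A = i) (hM : Module.finrank K (A × M) = n - i) :
    IsMorphism K (Y := AffineSp K ((A →ₗ[K] M × C) × (A × M →ₗ[K] C) × (A →ₗ[K] C)))
      (fun L : {L : stratum K V n i // L.1.1 ∈ chartDom (sumDecomp e) n} =>
        stratumCoord e L.1) := by
  have h1 : IsMorphism K (fun L : {L : stratum K V n i // L.1.1 ∈ chartDom (sumDecomp e) n} =>
      (⟨L.1.1.1, L.2⟩ : chartDom (sumDecomp e) n)) :=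
    IsMorphism.codRestrict (isMorphism_stratum_val.comp (isMorphism_val (K := K)))
  exact (isMorphism_linearMap (splitHom K A M C)).comp
    ((isMorphism_chartCoord (sumDecomp e) (finrank_sumDecomp_source hi hA hM)).comp h1)

/-- In charts, the coordinates of `F` and `G` are blocks of the coordinate of `L`. -/
theorem isMorphism_flagOf (hi : i ≤ n) :
    IsMorphism K (flagOf : stratum K V n i → FlagVar K V i (n - i)) := by
  refine isMorphism_of_forall_exists_isOpen fun L => ?_
  obtain ⟨A, M, C, e, hA, hM, hL⟩ := exists_mem_flagDom (flagOf L)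
  have hD := finrank_sumDecomp_source hi hA hM
  refine ⟨{L | L.1.1 ∈ chartDom (sumDecomp e) n}, (isOpen_chartDom (sumDecomp e) hD).preimage
    isMorphism_stratum_val.1, (mem_chartDom_iff_flagOf_mem e hM L).2 hL, ?_⟩
  have hc := isMorphism_stratumCoord e hi hA hM
  have h1 := (isMorphism_chartMap e hA).comp ((isMorphism_linearMap (B := A →ₗ[K] M × C)
    (LinearMap.fst K _ ((A × M →ₗ[K] C) × (A →ₗ[K] C)))).comp hc)
  have h2 := (isMorphism_chartMap (bigDecomp e) hM).comp
    ((isMorphism_linearMap (A := (A →ₗ[K] M × C) × (A × M →ₗ[K] C) × (A →ₗ[K] C))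
      (B := A × M →ₗ[K] C) (LinearMap.fst K _ _ ∘ₗ LinearMap.snd K _ _)).comp hc)
  refine IsMorphism.codRestrict ?_
  convert isMorphism_prodMk h1 h2 using 1
  funext L
  have hL := (mem_chartDom_iff_flagOf_mem e hM L.1).1 L.2
  change (⟨_, _⟩ : ProdSp K _ _) = ⟨_, _⟩
  congr 1
  · exact Subtype.ext (piPart_eq_chartSub e hi hA hM hL).symm
  · exact Subtype.ext (epsPart_eq_chartSub e hi hA hM hL).symm

end Bundle

theorem isMorphism_affine_prodMk {K : Type*} [Field K] {X : Type*} [TopologicalSpace X]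
    [SpaceWithFunctions K X] {A B : Type*} [AddCommGroup A] [Module K A] [AddCommGroup B]
    [Module K B] {φ : X → A} {ψ : X → B} (hφ : IsMorphism K (Y := AffineSp K A) φ)
    (hψ : IsMorphism K (Y := AffineSp K B) ψ) :
    IsMorphism K (Y := AffineSp K (A × B)) (fun x => (φ x, ψ x)) := by
  refine isMorphism_affine fun l x => ?_
  refine ((hφ.dual (l ∘ₗ LinearMap.inl K A B) x).add
    (hψ.dual (l ∘ₗ LinearMap.inr K A B) x)).congr (Eventually.of_forall fun y => ?_)
  change l (φ y, 0) + l (0, ψ y) = l (φ y, ψ y)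
  rw [← map_add]
  simp

section Bundle

variable {K : Type*} [Field K] {V : Type*} [AddCommGroup V] [Module K V] [FiniteDimensional K V]
  {A M C : Type*} [AddCommGroup A] [Module K A] [AddCommGroup M] [Module K M]
  [AddCommGroup C] [Module K C] [FiniteDimensional K A] [FiniteDimensional K M]
  {n i : ℕ}

/-- The coordinates of a flag, together with a linear map. -/
noncomputable def flagCoord (e : V ≃ₗ[K] A × M × C) (b : FlagVar K V i (n - i)) (φ : A →ₗ[K] C) :
    (A →ₗ[K] M × C) × (A × M →ₗ[K] C) × (A →ₗ[K] C) :=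
  (chartCoord e b.1.fst.1, chartCoord (bigDecomp e) b.1.snd.1, φ)

theorem exists_fiber_linearEquiv (e : V ≃ₗ[K] A × M × C) (hA : Module.finrank K A = i)
    (hM : Module.finrank K (A × M) = n - i) {b : FlagVar K V i (n - i)} (hb : b ∈ flagDom e n i) :
    ∃ ε : (A →ₗ[K] C) ≃ₗ[K] (b.1.fst.1 →ₗ[K] V ⧸ b.1.snd.1), ∀ φ,
      homSubmodule b.1.fst.1 b.1.snd.1 (ε φ) =
        chartSub (sumDecomp e) (assembleHom K A M C (flagCoord e b φ)) := by
  have h := homSubmodule_chartSub e (chartCoord e b.1.fst.1) (chartCoord (bigDecomp e) b.1.snd.1)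
  rwa [chartSub_chartCoord e hA hb.1, chartSub_chartCoord (bigDecomp e) hM hb.2] at h

/-- The point of a stratum with given flag and linear map. -/
noncomputable def stratumPoint (e : V ≃ₗ[K] A × M × C) (hi : i ≤ n) (hA : Module.finrank K A = i)
    (hM : Module.finrank K (A × M) = n - i) {b : FlagVar K V i (n - i)} (hb : b ∈ flagDom e n i)
    (φ : A →ₗ[K] C) : stratum K V n i :=
  stratumMk hi b (chartSub (sumDecomp e) (assembleHom K A M C (flagCoord e b φ)))
    ((piPart_chartSub_assembleHom e _).trans (chartSub_chartCoord e hA hb.1))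
    ((epsPart_chartSub_assembleHom e _).trans (chartSub_chartCoord (bigDecomp e) hM hb.2))

theorem flagOf_stratumPoint (e : V ≃ₗ[K] A × M × C) (hi : i ≤ n) (hA : Module.finrank K A = i)
    (hM : Module.finrank K (A × M) = n - i) {b : FlagVar K V i (n - i)} (hb : b ∈ flagDom e n i)
    (φ : A →ₗ[K] C) : flagOf (stratumPoint e hi hA hM hb φ) = b :=
  flagOf_stratumMk hi b _ _ _

theorem stratumCoord_stratumPoint (e : V ≃ₗ[K] A × M × C) (hi : i ≤ n)
    (hA : Module.finrank K A = i) (hM : Module.finrank K (A × M) = n - i)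
    {b : FlagVar K V i (n - i)} (hb : b ∈ flagDom e n i) (φ : A →ₗ[K] C) :
    stratumCoord e (stratumPoint e hi hA hM hb φ) = flagCoord e b φ :=
  (congrArg (splitHom K A M C) (chartCoord_chartSub (sumDecomp e) _)).trans
    (splitHom_assembleHom _)

theorem flagCoord_flagOf (e : V ≃ₗ[K] A × M × C) (hi : i ≤ n)
    (hA : Module.finrank K A = i) (hM : Module.finrank K (A × M) = n - i)
    {L : stratum K V n i} (hL : flagOf L ∈ flagDom e n i) :
    flagCoord e (flagOf L) (stratumCoord e L).2.2 = stratumCoord e L := by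
  refine Prod.ext ?_ (Prod.ext ?_ rfl)
  · change chartCoord e (piPart L.1.1.1) = _
    rw [← piPart_eq_chartSub e hi hA hM hL, chartCoord_chartSub]
  · change chartCoord (bigDecomp e) (epsPart L.1.1.1) = _
    rw [← epsPart_eq_chartSub e hi hA hM hL, chartCoord_chartSub]

/-- The local trivialization of a stratum over the flag variety. -/
noncomputable def stratumTrivialization (e : V ≃ₗ[K] A × M × C) (hi : i ≤ n)
    (hA : Module.finrank K A = i) (hM : Module.finrank K (A × M) = n - i) {m : ℕ}
    (β : (Fin m → K) ≃ₗ[K] (A →ₗ[K] C)) :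
    ProdSp K (flagDom e n i) (AffineSp K (Fin m → K)) ≃
      {L : stratum K V n i // flagOf L ∈ flagDom e n i} where
  toFun z := ⟨stratumPoint e hi hA hM z.fst.2 (β z.snd),
    (flagOf_stratumPoint e hi hA hM z.fst.2 _).symm ▸ z.fst.2⟩
  invFun L := ⟨⟨flagOf L.1, L.2⟩, β.symm (stratumCoord e L.1).2.2⟩
  left_inv z := by
    obtain ⟨⟨b, hb⟩, c⟩ := z
    have h1 : flagOf (stratumPoint e hi hA hM hb (β c)) = b := flagOf_stratumPoint e hi hA hM hb _
    have h2 : β.symm (stratumCoord e (stratumPoint e hi hA hM hb (β c))).2.2 = c := by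
      rw [stratumCoord_stratumPoint]
      exact β.symm_apply_apply c
    simp only [h1, h2]
  right_inv L := by
    refine Subtype.ext (Subtype.ext (Subtype.ext (Subtype.ext ?_)))
    change chartSub (sumDecomp e) (assembleHom K A M C (flagCoord e (flagOf L.1)
      (β (β.symm (stratumCoord e L.1).2.2)))) = _
    rw [β.apply_symm_apply, flagCoord_flagOf e hi hA hM L.2, chartSub_stratumCoord e hi hA hM L.2]

theorem isMorphism_stratumTrivialization (e : V ≃ₗ[K] A × M × C) (hi : i ≤ n)
    (hA : Module.finrank K A = i) (hM : Module.finrank K (A × M) = n - i) {m : ℕ}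
    (β : (Fin m → K) ≃ₗ[K] (A →ₗ[K] C)) :
    IsMorphism K (stratumTrivialization e hi hA hM β) := by
  have hD := finrank_sumDecomp_source hi hA hM
  have hval : IsMorphism K (fun z : ProdSp K (flagDom e n i) (AffineSp K (Fin m → K)) =>
      z.fst.1.1) := isMorphism_val.comp (isMorphism_val.comp isMorphism_fst)
  have h1 : IsMorphism K (Y := AffineSp K (A →ₗ[K] M × C))
      (fun z : ProdSp K (flagDom e n i) (AffineSp K (Fin m → K)) =>
        chartCoord e z.fst.1.1.fst.1) :=
    (isMorphism_chartCoord e hA).comp (φ := fun z : ProdSp K (flagDom e n i)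
      (AffineSp K (Fin m → K)) => ⟨z.fst.1.1.fst, z.fst.2.1⟩)
      (IsMorphism.codRestrict (isMorphism_fst.comp hval))
  have h2 : IsMorphism K (Y := AffineSp K (A × M →ₗ[K] C))
      (fun z : ProdSp K (flagDom e n i) (AffineSp K (Fin m → K)) =>
        chartCoord (bigDecomp e) z.fst.1.1.snd.1) :=
    (isMorphism_chartCoord (bigDecomp e) hM).comp (φ := fun z : ProdSp K (flagDom e n i)
      (AffineSp K (Fin m → K)) => ⟨z.fst.1.1.snd, z.fst.2.2⟩)
      (IsMorphism.codRestrict (isMorphism_snd.comp hval))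
  have h3 : IsMorphism K (Y := AffineSp K (A →ₗ[K] C))
      (fun z : ProdSp K (flagDom e n i) (AffineSp K (Fin m → K)) => β z.snd) :=
    (isMorphism_linearMap β.toLinearMap).comp isMorphism_snd
  refine IsMorphism.codRestrict (IsMorphism.codRestrict (IsMorphism.codRestrict ?_))
  exact (isMorphism_chartMap (sumDecomp e) hD).comp ((isMorphism_linearMap
    (assembleHom K A M C)).comp (isMorphism_affine_prodMk h1 (isMorphism_affine_prodMk h2 h3)))

theorem isMorphism_stratumTrivialization_symm (e : V ≃ₗ[K] A × M × C) (hi : i ≤ n)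
    (hA : Module.finrank K A = i) (hM : Module.finrank K (A × M) = n - i) {m : ℕ}
    (β : (Fin m → K) ≃ₗ[K] (A →ₗ[K] C)) :
    IsMorphism K (stratumTrivialization e hi hA hM β).symm := by
  refine isMorphism_prodMk (IsMorphism.codRestrict ((isMorphism_flagOf hi).comp isMorphism_val)) ?_
  have h1 : IsMorphism K (fun L : {L : stratum K V n i // flagOf L ∈ flagDom e n i} =>
      (⟨L.1, (mem_chartDom_iff_flagOf_mem e hM L.1).2 L.2⟩ :
        {L : stratum K V n i // L.1.1 ∈ chartDom (sumDecomp e) n})) :=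
    IsMorphism.codRestrict isMorphism_val
  exact (isMorphism_linearMap (A := (A →ₗ[K] M × C) × (A × M →ₗ[K] C) × (A →ₗ[K] C))
    (β.symm.toLinearMap ∘ₗ LinearMap.snd K _ _ ∘ₗ LinearMap.snd K _ _)).comp
    ((isMorphism_stratumCoord e hi hA hM).comp h1)

theorem isVectorBundle_flagOf (hi : i ≤ n) :
    IsVectorBundle K (flagOf : stratum K V n i → FlagVar K V i (n - i))
      (fun b => b.1.fst.1 →ₗ[K] V ⧸ b.1.snd.1) (fiberEquiv hi) where
  isMorphism := isMorphism_flagOf hi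
  locallyTrivial b := by
    obtain ⟨A, M, C, e, hA, hM, hb⟩ := exists_mem_flagDom b
    let β := (Module.finBasis K (A →ₗ[K] C)).equivFun.symm
    refine ⟨flagDom e n i, isOpen_flagDom e hA hM, hb, _, stratumTrivialization e hi hA hM β,
      isMorphism_stratumTrivialization e hi hA hM β,
      isMorphism_stratumTrivialization_symm e hi hA hM β,
      fun u c => flagOf_stratumPoint e hi hA hM u.2 _, fun u => ?_⟩
    obtain ⟨ε, hε⟩ := exists_fiber_linearEquiv e hA hM u.2
    refine ⟨β.trans ε, fun c => Subtype.ext (Subtype.ext (Subtype.ext ?_))⟩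
    exact (hε (β c)).symm

end Bundle

/-! ### Krull dimension of finitely generated domains. -/

open Algebra in
-- Incomparability gives `≤`. For `≥`, lying over lifts the smallest prime of a chain, and going up,
-- deduced from closedness of the map of spectra, lifts the rest.
theorem ringKrullDim_eq_of_isIntegral_of_injective {R S : Type*} [CommRing R] [CommRing S]
    [Algebra R S] [Algebra.IsIntegral R S] [FaithfulSMul R S] :
    ringKrullDim S = ringKrullDim R := by

  apply le_antisymm
  · refine Order.krullDim_le_of_strictMono (PrimeSpectrum.comap (algebraMap R S)) fun p q h => ?_
    exact Ideal.IsIntegral.comap_lt_comap (R := R) (I := p.asIdeal) (J := q.asIdeal) h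
  · have : Algebra.HasGoingUp R S := Algebra.HasGoingUp.iff_specializingMap_primeSpectrumComap.2
      (PrimeSpectrum.isClosedMap_comap_of_isIntegral (algebraMap R S)
        (algebraMap_isIntegral_iff.2 inferInstance)).specializingMap
    refine iSup_le fun l => ?_
    obtain ⟨P, hP⟩ := Algebra.IsIntegral.comap_surjective R S l.head
    have : P.asIdeal.LiesOver l.head.asIdeal := ⟨by rw [← hP]; rfl⟩
    obtain ⟨L, hL, -⟩ := Ideal.exists_ltSeries_of_hasGoingUp l P.asIdeal
    rw [← hL]
    exact le_iSup (fun L : LTSeries (PrimeSpectrum S) => (L.length : WithBot ℕ∞)) L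

/-- By Noether normalization, `A` is integral over a polynomial ring in `s` variables, and neither
invariant changes under an injective integral extension. -/
theorem exists_trdeg_eq_and_ringKrullDim_eq (K : Type*) [Field K] (A : Type*) [CommRing A]
    [IsDomain A] [Algebra K A] [Algebra.FiniteType K A] :
    ∃ s : ℕ, Algebra.trdeg K A = s ∧ ringKrullDim A = s := by
  obtain ⟨s, g, hg, hi⟩ := exists_integral_inj_algHom_of_fg K A
  let := g.toRingHom.toAlgebra
  have : IsScalarTower K (MvPolynomial (Fin s) K) A :=
    IsScalarTower.of_algebraMap_eq fun x => (g.commutes x).symm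
  have : Algebra.IsIntegral (MvPolynomial (Fin s) K) A := ⟨hi⟩
  have : FaithfulSMul (MvPolynomial (Fin s) K) A :=
    (faithfulSMul_iff_algebraMap_injective _ _).2 hg
  refine ⟨s, ?_, ?_⟩
  · have h := lift_trdeg_add_eq K (MvPolynomial (Fin s) K) A
    rw [trdeg_eq_zero (R := MvPolynomial (Fin s) K), MvPolynomial.trdeg_of_isDomain] at h
    simpa using h.symm
  · rw [ringKrullDim_eq_of_isIntegral_of_injective (R := MvPolynomial (Fin s) K)]
    simp

/-- Both rings are finitely generated domains, so the dimension is the transcendence degree, which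
is insensitive to the algebraic extension `A → A_f`. -/
theorem ringKrullDim_localizationAway (K : Type*) [Field K] (A : Type*) [CommRing A]
    [IsDomain A] [Algebra K A] [Algebra.FiniteType K A] {f : A} (hf : f ≠ 0) :
    ringKrullDim (Localization.Away f) = ringKrullDim A := by
  have hle : Submonoid.powers f ≤ nonZeroDivisors A := powers_le_nonZeroDivisors_of_noZeroDivisors hf
  have : IsDomain (Localization.Away f) := IsLocalization.isDomain_localization hle
  have : Algebra.FiniteType A (Localization.Away f) := IsLocalization.finiteType_of_monoid_fg (Submonoid.powers f) _
  have : Algebra.FiniteType K (Localization.Away f) := Algebra.FiniteType.trans (S := A) inferInstance inferInstance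
  have : FaithfulSMul A (Localization.Away f) :=
    (faithfulSMul_iff_algebraMap_injective _ _).2 (IsLocalization.injective _ hle)
  have : Algebra.IsAlgebraic A (Localization.Away f) := IsLocalization.isAlgebraic _ (Submonoid.powers f)
  obtain ⟨s, hs, hs'⟩ := exists_trdeg_eq_and_ringKrullDim_eq K A
  obtain ⟨t, ht, ht'⟩ := exists_trdeg_eq_and_ringKrullDim_eq K (Localization.Away f)
  have h := trdeg_add_eq (R := K) (S := A) (A := Localization.Away f)
  rw [trdeg_eq_zero (R := A), hs, ht, add_zero] at h
  rw [hs', ht', Nat.cast_injective h]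

theorem Topology.IsInducing.isIrreducible_of_image {X Y : Type*} [TopologicalSpace X]
    [TopologicalSpace Y] {f : X → Y} (hf : IsInducing f) {s : Set X} (h : IsIrreducible (f '' s)) :
    IsIrreducible s := by
  refine ⟨h.nonempty.of_image, ?_⟩
  intro U V hU hV hsU hsV
  obtain ⟨U', hU', rfl⟩ := hf.isOpen_iff.1 hU
  obtain ⟨V', hV', rfl⟩ := hf.isOpen_iff.1 hV
  obtain ⟨x, hx, hxU⟩ := hsU
  obtain ⟨y, hy, hyV⟩ := hsV
  obtain ⟨_, ⟨z, hz, rfl⟩, hzU, hzV⟩ :=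
    h.2 U' V' hU' hV' ⟨f x, ⟨x, hx, rfl⟩, hxU⟩ ⟨f y, ⟨y, hy, rfl⟩, hyV⟩
  exact ⟨z, hz, hzU, hzV⟩

/-! ### From Krull dimension of rings to dimension of spaces. -/

section Nullstellensatz

open MvPolynomial TopologicalSpace

variable {K : Type*} [Field K] {N : ℕ}

theorem mem_polyFun_iff {p : (Fin N → K) → K} :
    p ∈ polyFun K (Fin N → K) ↔ ∃ q : MvPolynomial (Fin N) K, ∀ x, aeval x q = p x := by
  constructor
  · intro hp
    induction hp using Algebra.adjoin_induction with
    | mem p hp =>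
      obtain ⟨l, rfl⟩ := hp
      refine ⟨∑ i, C (l fun j => if i = j then 1 else 0) * X i, fun x => ?_⟩
      change _ = l x
      rw [LinearMap.pi_apply_eq_sum_univ l x]
      simp [mul_comm]
    | algebraMap c => exact ⟨C c, fun x => by simp⟩
    | add p q _ _ hp hq =>
      obtain ⟨P, hP⟩ := hp
      obtain ⟨Q, hQ⟩ := hq
      exact ⟨P + Q, fun x => (map_add (aeval x) P Q).trans (by rw [hP, hQ]; rfl)⟩
    | mul p q _ _ hp hq =>
      obtain ⟨P, hP⟩ := hp
      obtain ⟨Q, hQ⟩ := hq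
      exact ⟨P * Q, fun x => (map_mul (aeval x) P Q).trans (by rw [hP, hQ]; rfl)⟩
  · rintro ⟨q, hq⟩
    obtain rfl : (fun x => aeval x q) = p := funext hq
    clear hq
    induction q using MvPolynomial.induction_on with
    | C c =>
      convert Subalgebra.algebraMap_mem (polyFun K (Fin N → K)) c using 1
      funext x
      simp
    | add p q hp hq =>
      convert add_mem hp hq using 1
      funext x
      simp
    | mul_X p i hp =>
      convert mul_mem hp (dual_mem_polyFun (LinearMap.proj (R := K) (φ := fun _ : Fin N => K) i))
        using 1
      funext x
      simp

theorem isOpen_aeval_ne_zero (q : MvPolynomial (Fin N) K) :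
    IsOpen {x : AffineSp K (Fin N → K) | aeval (x : Fin N → K) q ≠ 0} :=
  isOpen_polyFun_ne_zero (mem_polyFun_iff.2 ⟨q, fun _ => rfl⟩)

theorem exists_aeval_ne_zero_of_mem_isOpen {U : Set (AffineSp K (Fin N → K))} (hU : IsOpen U)
    {x : AffineSp K (Fin N → K)} (hx : x ∈ U) : ∃ q : MvPolynomial (Fin N) K,
      aeval (x : Fin N → K) q ≠ 0 ∧ ∀ y : Fin N → K, aeval y q ≠ 0 → y ∈ U := by
  obtain ⟨p, hp, hpx, hpU⟩ := hU x hx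
  obtain ⟨q, hq⟩ := mem_polyFun_iff.1 hp
  exact ⟨q, (hq x).trans_ne hpx, fun y hy => hpU y (by rwa [← hq])⟩

theorem isClosed_zeroLocus (I : Ideal (MvPolynomial (Fin N) K)) :
    IsClosed (X := AffineSp K (Fin N → K)) (zeroLocus K I) := by
  refine ⟨isOpen_iff_mem_nhds.2 fun x hx => ?_⟩
  obtain ⟨q, hq, hqx⟩ : ∃ q ∈ I, aeval (x : Fin N → K) q ≠ 0 := by
    by_contra! h
    exact hx h
  exact mem_of_superset ((isOpen_aeval_ne_zero q).mem_nhds hqx) fun y hy hyI => hy (hyI q hq)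

theorem zeroLocus_vanishingIdeal_of_isClosed {Z : Set (AffineSp K (Fin N → K))}
    (hZ : IsClosed Z) : zeroLocus K (vanishingIdeal K (Z : Set (Fin N → K))) = Z := by
  refine subset_antisymm (fun x hx => ?_) (zeroLocus_vanishingIdeal_le (k := K) _)
  by_contra hxZ
  obtain ⟨q, hqx, hq⟩ := exists_aeval_ne_zero_of_mem_isOpen hZ.isOpen_compl hxZ
  refine hqx (hx q fun y hy => ?_)
  by_contra h
  exact hq y h hy

theorem isPrime_vanishingIdeal {Z : Set (AffineSp K (Fin N → K))} (hZ : IsIrreducible Z) :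
    (vanishingIdeal K (Z : Set (Fin N → K))).IsPrime := by
  refine Ideal.isPrime_iff.2 ⟨fun h => ?_, fun {p q} hpq => ?_⟩
  · obtain ⟨x, hx⟩ := hZ.nonempty
    have h1 : (1 : MvPolynomial (Fin N) K) ∈ vanishingIdeal K (Z : Set (Fin N → K)) :=
      h ▸ Submodule.mem_top
    exact one_ne_zero ((map_one (aeval (x : Fin N → K))).symm.trans (h1 x hx))
  · by_contra! h
    have key : ∀ p ∉ vanishingIdeal K (Z : Set (Fin N → K)),
        (Z ∩ {x : AffineSp K (Fin N → K) | aeval (x : Fin N → K) p ≠ 0}).Nonempty := by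
      intro p hp
      by_contra h
      exact hp fun x hx => by_contra fun h' => h ⟨x, hx, h'⟩
    obtain ⟨x, hx, hxp, hxq⟩ := hZ.2 _ _ (isOpen_aeval_ne_zero p) (isOpen_aeval_ne_zero q)
      (key p h.1) (key q h.2)
    exact mul_ne_zero hxp hxq ((map_mul (aeval (x : Fin N → K)) p q).symm.trans (hpq x hx))

variable [IsAlgClosed K]

/-- If `g` vanishes where `f ≠ 0` on the zero locus, then `f * g` vanishes on the whole locus. By
the Nullstellensatz `f * g ∈ P`, and `f ∉ P`. -/
theorem vanishingIdeal_zeroLocus_inter (P : Ideal (MvPolynomial (Fin N) K)) [P.IsPrime]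
    {f : MvPolynomial (Fin N) K} (hf : f ∉ P) :
    vanishingIdeal K (zeroLocus K P ∩ {x : Fin N → K | aeval x f ≠ 0}) = P := by
  refine le_antisymm (fun g hg => ?_) fun g hg x hx => hx.1 g hg
  have h : f * g ∈ vanishingIdeal K (zeroLocus K P) := by
    intro x hx
    rw [map_mul]
    by_cases h : aeval x f = 0
    · rw [h, zero_mul]
    · rw [hg x ⟨hx, h⟩, mul_zero]
  rw [IsPrime.vanishingIdeal_zeroLocus P] at h
  exact (Ideal.IsPrime.mem_or_mem ‹_› h).resolve_left hf

theorem isIrreducible_zeroLocus_inter (P : Ideal (MvPolynomial (Fin N) K)) [P.IsPrime]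
    {f : MvPolynomial (Fin N) K} (hf : f ∉ P) :
    IsIrreducible (X := AffineSp K (Fin N → K))
      (zeroLocus K P ∩ {x : Fin N → K | aeval x f ≠ 0}) := by
  have key : ∀ g ∉ P, ∃ x ∈ zeroLocus K P ∩ {x : Fin N → K | aeval x f ≠ 0}, aeval x g ≠ 0 := by
    intro g hg
    by_contra! h
    exact hg (by rwa [← vanishingIdeal_zeroLocus_inter P hf])
  constructor
  · obtain ⟨x, hx, -⟩ := key f hf
    exact ⟨x, hx⟩
  · rintro U V hU hV ⟨x, hx, hxU⟩ ⟨y, hy, hyV⟩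
    obtain ⟨p, hp, hpU⟩ := exists_aeval_ne_zero_of_mem_isOpen hU hxU
    obtain ⟨q, hq, hqV⟩ := exists_aeval_ne_zero_of_mem_isOpen hV hyV
    obtain ⟨z, hz, hpq⟩ := key (p * q) fun h =>
      (Ideal.IsPrime.mem_or_mem ‹_› h).elim (fun h => hp (hx.1 p h)) fun h => hq (hy.1 q h)
    rw [map_mul] at hpq
    exact ⟨z, hz, hpU z (left_ne_zero_of_mul hpq), hqV z (right_ne_zero_of_mul hpq)⟩

/-- Irreducible closed subsets of affine space correspond to prime ideals. -/
noncomputable def irreducibleClosedsOrderIso :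
    IrreducibleCloseds (AffineSp K (Fin N → K)) ≃o (PrimeSpectrum (MvPolynomial (Fin N) K))ᵒᵈ where
  toFun Z := OrderDual.toDual ⟨vanishingIdeal K (Z : Set (AffineSp K (Fin N → K))),
    isPrime_vanishingIdeal Z.isIrreducible⟩
  invFun P :=
    { carrier := zeroLocus K (OrderDual.ofDual P).asIdeal
      isIrreducible' := by
        have := isIrreducible_zeroLocus_inter (OrderDual.ofDual P).asIdeal (f := 1)
          ((Ideal.ne_top_iff_one _).1 (OrderDual.ofDual P).2.ne_top)
        have h1 : zeroLocus K (OrderDual.ofDual P).asIdeal ∩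
            {x : Fin N → K | aeval x (1 : MvPolynomial (Fin N) K) ≠ 0} =
              zeroLocus K (OrderDual.ofDual P).asIdeal :=
          inter_eq_left.2 fun x _ => (map_one (aeval (R := K) x)).trans_ne one_ne_zero
        exact (congrArg (fun S : Set (AffineSp K (Fin N → K)) => IsIrreducible S) h1).mp this
      isClosed' := isClosed_zeroLocus _ }
  left_inv Z := IrreducibleCloseds.ext (zeroLocus_vanishingIdeal_of_isClosed Z.isClosed)
  right_inv P := congrArg OrderDual.toDual (PrimeSpectrum.ext
    (IsPrime.vanishingIdeal_zeroLocus (OrderDual.ofDual P).asIdeal))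
  map_rel_iff' {Z Z'} := by
    refine ⟨fun h => ?_, fun h => vanishingIdeal_anti_mono h⟩
    have h1 : zeroLocus K (vanishingIdeal K (Z : Set (AffineSp K (Fin N → K)))) ⊆
      zeroLocus K (vanishingIdeal K (Z' : Set (AffineSp K (Fin N → K)))) := zeroLocus_anti_mono h
    rwa [zeroLocus_vanishingIdeal_of_isClosed Z.isClosed,
      zeroLocus_vanishingIdeal_of_isClosed Z'.isClosed] at h1

theorem topologicalKrullDim_affineSp : topologicalKrullDim (AffineSp K (Fin N → K)) = N := by
  rw [topologicalKrullDim, Order.krullDim_eq_of_orderIso irreducibleClosedsOrderIso,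
    Order.krullDim_orderDual]
  change ringKrullDim (MvPolynomial (Fin N) K) = N
  simp

/-- Let `R` be the coordinate ring of `Y` and `F ∈ R` a nonzero function whose nonvanishing locus
`U₀` lies in `U`. Chains of closed irreducible sets in `Y` give chains of primes in `R`; `dim R =
dim R_F`; and chains of primes in `R_F` give chains of closed irreducible sets in `U₀`. This yields
`dim Y ≤ dim R = dim R_F ≤ dim U₀ ≤ dim U`. -/
theorem topologicalKrullDim_le_of_isOpen {Y : Type*} [TopologicalSpace Y] [IrreducibleSpace Y]
    {g : Y → AffineSp K (Fin N → K)} (hg : IsClosedEmbedding g) {U : Set Y} (hU : IsOpen U)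
    (hne : U.Nonempty) : topologicalKrullDim Y ≤ topologicalKrullDim U := by
  obtain ⟨u, hu⟩ := hne
  obtain ⟨U', hU', rfl⟩ := hg.isOpen_iff.1 hU
  obtain ⟨f, hfu, hf⟩ := exists_aeval_ne_zero_of_mem_isOpen hU' hu
  let I : Ideal (MvPolynomial (Fin N) K) := vanishingIdeal K (Set.range g : Set (Fin N → K))
  have hI : I.IsPrime := isPrime_vanishingIdeal
    (Set.image_univ ▸ (IrreducibleSpace.isIrreducible_univ Y).image g hg.continuous.continuousOn)
  have hZ : zeroLocus K I = Set.range g := zeroLocus_vanishingIdeal_of_isClosed hg.isClosed_range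
  have hfI : f ∉ I := fun h => hfu (h _ ⟨u, rfl⟩)
  let R := MvPolynomial (Fin N) K ⧸ I
  let F : R := Ideal.Quotient.mk I f
  have hF : F ≠ 0 := fun h => hfI (Ideal.Quotient.eq_zero_iff_mem.1 h)
  have h1 : topologicalKrullDim Y ≤ ringKrullDim R := by
    rw [ringKrullDim_quotient, ← Order.krullDim_orderDual]
    refine Order.krullDim_le_of_strictMono (fun T => OrderDual.toDual
      ⟨OrderDual.ofDual (irreducibleClosedsOrderIso (IrreducibleCloseds.map g hg.continuous T)),
        ?_⟩) ?_
    · refine vanishingIdeal_anti_mono (closure_minimal ?_ hg.isClosed_range)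
      exact Set.image_subset_range g T
    · intro T T' h
      exact irreducibleClosedsOrderIso.strictMono
        (IrreducibleCloseds.map_strictMono_of_isInducing hg.isInducing h)
  have h2 : ringKrullDim (Localization.Away F) = ringKrullDim R :=
    ringKrullDim_localizationAway K R hF
  let U₀ : Set Y := {y | aeval (g y : Fin N → K) f ≠ 0}
  have hU₀ : U₀ ⊆ g ⁻¹' U' := fun y hy => hf _ hy
  have hj : IsInducing (fun y : U₀ => g y) := hg.isInducing.comp IsInducing.subtypeVal
  let c : MvPolynomial (Fin N) K →+* Localization.Away F :=
    (algebraMap R (Localization.Away F)).comp (Ideal.Quotient.mk I)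
  have hc : ∀ Q : PrimeSpectrum (Localization.Away F),
      f ∉ (PrimeSpectrum.comap c Q).asIdeal ∧ I ≤ (PrimeSpectrum.comap c Q).asIdeal := by
    intro Q
    constructor
    · intro h
      exact Q.2.ne_top (Ideal.eq_top_of_isUnit_mem _ h
        (IsLocalization.map_units (Localization.Away F) ⟨F, Submonoid.mem_powers F⟩))
    · intro p hp
      change algebraMap R (Localization.Away F) (Ideal.Quotient.mk I p) ∈ Q.asIdeal
      rw [Ideal.Quotient.eq_zero_iff_mem.2 hp, map_zero]
      exact Q.asIdeal.zero_mem
  have hcinj : Function.Injective (PrimeSpectrum.comap c) := by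
    rw [PrimeSpectrum.comap_comp]
    exact (PrimeSpectrum.comap_injective_of_surjective _ Ideal.Quotient.mk_surjective).comp
      (PrimeSpectrum.localization_comap_injective _ (Submonoid.powers F))
  -- The contracted prime contains `I`, so its zero locus lies inside the closed set `range g`; no
  -- point is lost by pulling back to `U₀`.
  have himg : ∀ Q : PrimeSpectrum (Localization.Away F), (fun y : U₀ => g y) ''
      ((fun y : U₀ => g y) ⁻¹' zeroLocus K (PrimeSpectrum.comap c Q).asIdeal) =
        zeroLocus K (PrimeSpectrum.comap c Q).asIdeal ∩ {x : Fin N → K | aeval x f ≠ 0} := by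
    intro Q
    ext x
    constructor
    · rintro ⟨y, hy, rfl⟩
      exact ⟨hy, y.2⟩
    · rintro ⟨hx, hxf⟩
      obtain ⟨y, rfl⟩ : x ∈ Set.range g := hZ ▸ zeroLocus_anti_mono (hc Q).2 hx
      exact ⟨⟨y, hxf⟩, hx, rfl⟩
  let T : PrimeSpectrum (Localization.Away F) → IrreducibleCloseds U₀ := fun Q =>
    { carrier := (fun y : U₀ => g y) ⁻¹' zeroLocus K (PrimeSpectrum.comap c Q).asIdeal
      isIrreducible' := by
        refine hj.isIrreducible_of_image ?_
        rw [himg]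
        exact isIrreducible_zeroLocus_inter _ (hc Q).1
      isClosed' := (isClosed_zeroLocus _).preimage hj.continuous }
  -- A prime not containing `f` is recovered as the vanishing ideal of its locus inside `f ≠ 0`.
  -- With monotonicity, this makes `T` strict on chains.
  have hTinj : Function.Injective T := by
    intro Q Q' h
    refine hcinj (PrimeSpectrum.ext ?_)
    have h' := congrArg (fun Z : IrreducibleCloseds U₀ => (fun y : U₀ => g y) '' (Z : Set U₀)) h
    have h' := congrArg (fun S : Set (Fin N → K) => vanishingIdeal K S)
      ((himg Q).symm.trans (h'.trans (himg Q')))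
    simpa only [vanishingIdeal_zeroLocus_inter _ (hc Q).1,
      vanishingIdeal_zeroLocus_inter _ (hc Q').1] using h'
  have hTanti : Antitone T := fun Q Q' h y hy =>
    zeroLocus_anti_mono (K := K) (I := (PrimeSpectrum.comap c Q).asIdeal) (Ideal.comap_mono h) hy
  have h3 : ringKrullDim (Localization.Away F) ≤ topologicalKrullDim U₀ := by
    rw [topologicalKrullDim, ← Order.krullDim_orderDual]
    exact Order.krullDim_le_of_strictMono (OrderDual.toDual ∘ T)
      ((show Monotone (OrderDual.toDual ∘ T) from hTanti).strictMono_of_injective hTinj)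
  exact ((h1.trans h2.ge).trans h3).trans
    (Topology.IsEmbedding.inclusion hU₀).isInducing.topologicalKrullDim_le

/-- A chain of closed irreducible sets keeps its length in an open chart `O` around a point of its
smallest member. By irreducibility `O` meets `O'`, so `dim O ≤ dim (O ∩ O') ≤ dim O' = d`. -/
theorem topologicalKrullDim_eq_of_charts {X : Type*} [TopologicalSpace X] [IrreducibleSpace X]
    {d : ℕ} (hX : ∀ x : X, ∃ (O : Set X) (N : ℕ) (g : O → AffineSp K (Fin N → K)),
      IsOpen O ∧ x ∈ O ∧ IsClosedEmbedding g)
    {O' : Set X} (hO' : IsOpen O') (φ : O' ≃ₜ AffineSp K (Fin d → K)) :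
    topologicalKrullDim X = d := by
  have hd : topologicalKrullDim O' = d :=
    φ.isHomeomorph.topologicalKrullDim_eq.trans topologicalKrullDim_affineSp
  have hne : O'.Nonempty := ⟨_, (φ.symm (0 : Fin d → K)).2⟩
  refine le_antisymm (iSup_le fun l => ?_) (hd ▸ topologicalKrullDim_subspace_le X O')
  obtain ⟨x, hx⟩ := l.head.isIrreducible.nonempty
  obtain ⟨O, N, g, hO, hxO, hg⟩ := hX x
  have hmem : ∀ j, l.toFun j ∈ {V : IrreducibleCloseds X |
      ((Subtype.val : O → X) ⁻¹' V).Nonempty} :=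
    fun j => ⟨⟨x, hxO⟩, (l.head_le j : l.head ≤ l.toFun j) hx⟩
  let l' : LTSeries {V : IrreducibleCloseds X | ((Subtype.val : O → X) ⁻¹' V).Nonempty} :=
    ⟨l.length, fun j => ⟨l.toFun j, hmem j⟩, fun j => l.step j⟩
  have h1 : (l.length : WithBot ℕ∞) ≤ topologicalKrullDim O := by
    rw [topologicalKrullDim, Order.krullDim_eq_of_orderIso
      (IrreducibleCloseds.orderIsoOfIsOpenEmbedding _ hO.isOpenEmbedding_subtypeVal)]
    exact le_iSup (fun l : LTSeries _ => (l.length : WithBot ℕ∞)) l'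
  have hirr : IsIrreducible O := ⟨⟨x, hxO⟩,
    (PreirreducibleSpace.isPreirreducible_univ (X := X)).open_subset hO (subset_univ _)⟩
  have : IrreducibleSpace O := (isIrreducible_iff_irreducibleSpace).1 hirr
  obtain ⟨z, -, hzO, hzO'⟩ := (PreirreducibleSpace.isPreirreducible_univ (X := X)) O O' hO hO'
    ⟨x, mem_univ _, hxO⟩ (hne.imp fun y hy => ⟨mem_univ _, hy⟩)
  have h2 := topologicalKrullDim_le_of_isOpen hg (hO'.preimage continuous_subtype_val)
    ⟨⟨z, hzO⟩, hzO'⟩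
  have h3 : IsInducing (fun y : ((Subtype.val : O → X) ⁻¹' O') => (⟨y.1.1, y.2⟩ : O')) :=
    IsInducing.of_comp (by fun_prop) continuous_subtype_val
      (show IsInducing ((Subtype.val : O → X) ∘ Subtype.val) from
        IsInducing.subtypeVal.comp IsInducing.subtypeVal)
  exact (h1.trans h2).trans (h3.topologicalKrullDim_le.trans hd.le)

end Nullstellensatz

/-! ### Affine cells in the strata. -/

section Bilinear

variable {K : Type*} [Field K] {X : Type*} [TopologicalSpace X] [SpaceWithFunctions K X]
  {A B : Type*} [AddCommGroup A] [Module K A] [AddCommGroup B] [Module K B]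

theorem regularAt_bilinear [FiniteDimensional K A] {φ : X → A} {ψ : X → B} {x : X}
    (hφ : ∀ l : Module.Dual K A, RegularAt K (fun y => l (φ y)) x)
    (hψ : ∀ l : Module.Dual K B, RegularAt K (fun y => l (ψ y)) x) (β : A →ₗ[K] B →ₗ[K] K) :
    RegularAt K (fun y => β (φ y) (ψ y)) x := by
  let b := Module.finBasis K A
  refine (RegularAt.sum (s := Finset.univ) fun k _ => (hφ (b.coord k)).mul (hψ (β (b k)))).congr
    (Eventually.of_forall fun y => ?_)
  have h := congrArg (fun a => β a (ψ y)) (b.sum_repr (φ y))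
  rw [map_sum, LinearMap.sum_apply] at h
  simpa only [map_smul, LinearMap.smul_apply, smul_eq_mul, Module.Basis.coord_apply] using h

theorem isMorphism_linearEquiv_homeomorph (f : A ≃ₗ[K] B) :
    Nonempty (AffineSp K A ≃ₜ AffineSp K B) :=
  ⟨⟨f.toEquiv, (isMorphism_linearMap f.toLinearMap).1,
    (isMorphism_linearMap f.symm.toLinearMap).1⟩⟩

end Bilinear

section StratumChart

variable {K : Type*} [Field K] {V : Type*} [AddCommGroup V] [Module K V] [FiniteDimensional K V]
  {A M C : Type*} [AddCommGroup A] [Module K A] [AddCommGroup M] [Module K M]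
  [AddCommGroup C] [Module K C] [FiniteDimensional K A] [FiniteDimensional K M]
  {n i : ℕ}

variable (K A M C) in
/-- Forget the part of the coordinate of `F` that is determined by `F ⊆ G`. -/
def forgetHom : ((A →ₗ[K] M × C) × (A × M →ₗ[K] C) × (A →ₗ[K] C)) →ₗ[K]
    ((A →ₗ[K] M) × (A × M →ₗ[K] C) × (A →ₗ[K] C)) where
  toFun p := (LinearMap.fst K M C ∘ₗ p.1, p.2)
  map_add' _ _ := rfl
  map_smul' _ _ := rfl

/-- The coordinate of `F`, computed from the coordinate of `G` and from that of `F` in `G`. -/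
def recoverHom (p : (A →ₗ[K] M) × (A × M →ₗ[K] C) × (A →ₗ[K] C)) :
    (A →ₗ[K] M × C) × (A × M →ₗ[K] C) × (A →ₗ[K] C) :=
  (p.1.prod (p.2.1 ∘ₗ LinearMap.id.prod p.1), p.2)

/-- When `F`, the graph of `(a, c)`, lies in `G`, the graph of `b`, one has `c x = b (x, a x) = b
(x, 0) + b (0, a x)`. So the formula is a linear part `γ` plus a part `β` bilinear in `(a, b)`. -/
theorem isMorphism_recoverHom [FiniteDimensional K C] :
    IsMorphism K (X := AffineSp K ((A →ₗ[K] M) × (A × M →ₗ[K] C) × (A →ₗ[K] C)))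
      (Y := AffineSp K ((A →ₗ[K] M × C) × (A × M →ₗ[K] C) × (A →ₗ[K] C))) recoverHom := by
  have h2 := isMorphism_linearMap (LinearMap.snd K (A →ₗ[K] M) ((A × M →ₗ[K] C) × (A →ₗ[K] C)))
  refine isMorphism_affine_prodMk (isMorphism_affine fun l p => ?_) h2
  let β : (A →ₗ[K] M) →ₗ[K] (A × M →ₗ[K] C) →ₗ[K] K := LinearMap.mk₂ K
    (fun a b => l (LinearMap.inr K M C ∘ₗ b ∘ₗ LinearMap.inr K A M ∘ₗ a))
    (fun a a' b => by simp only [LinearMap.comp_add, map_add])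
    (fun c a b => by simp only [LinearMap.comp_smul, map_smul])
    (fun a b b' => by simp only [LinearMap.comp_add, LinearMap.add_comp, map_add])
    (fun c a b => by simp only [LinearMap.comp_smul, LinearMap.smul_comp, map_smul])
  let γ : ((A →ₗ[K] M) × (A × M →ₗ[K] C) × (A →ₗ[K] C)) →ₗ[K] K :=
    { toFun := fun p => l (LinearMap.inl K M C ∘ₗ p.1) +
        l (LinearMap.inr K M C ∘ₗ p.2.1 ∘ₗ LinearMap.inl K A M)
      map_add' := fun p q => by
        simp only [Prod.fst_add, Prod.snd_add, LinearMap.comp_add, LinearMap.add_comp, map_add]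
        abel
      map_smul' := fun c p => by
        simp only [Prod.smul_fst, Prod.smul_snd, LinearMap.comp_smul, LinearMap.smul_comp,
          map_smul, RingHom.id_apply, smul_add] }
  have hβ : RegularAt K
      (X := AffineSp K ((A →ₗ[K] M) × (A × M →ₗ[K] C) × (A →ₗ[K] C)))
      (fun p : (A →ₗ[K] M) × (A × M →ₗ[K] C) × (A →ₗ[K] C) => β p.1 p.2.1) p :=
    regularAt_bilinear (fun l => regularAt_dual (l ∘ₗ LinearMap.fst K _ _) p)
      (fun l => regularAt_dual (l ∘ₗ LinearMap.fst K _ _ ∘ₗ LinearMap.snd K _ _) p) β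
  refine ((regularAt_dual γ p).add hβ).congr (Eventually.of_forall fun q => ?_)
  obtain ⟨a, b, φ⟩ := (q : (A →ₗ[K] M) × (A × M →ₗ[K] C) × (A →ₗ[K] C))
  change l (LinearMap.inl K M C ∘ₗ a) + l (LinearMap.inr K M C ∘ₗ b ∘ₗ LinearMap.inl K A M) +
    l (LinearMap.inr K M C ∘ₗ b ∘ₗ LinearMap.inr K A M ∘ₗ a) =
      l (a.prod (b ∘ₗ LinearMap.id.prod a))
  rw [← map_add, ← map_add]
  congr 1
  refine LinearMap.ext fun x => Prod.ext ?_ ?_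
  · simp
  · simp [← map_add]

theorem chartSub_recoverHom_le (e : V ≃ₗ[K] A × M × C)
    (p : (A →ₗ[K] M) × (A × M →ₗ[K] C) × (A →ₗ[K] C)) :
    chartSub e (recoverHom p).1 ≤ chartSub (bigDecomp e) p.2.1 := by
  intro v hv
  have h := Prod.ext_iff.1 (mem_chartSub.1 hv)
  refine mem_chartSub.2 (h.2.trans ?_)
  change p.2.1 ((e v).1, p.1 (e v).1) = p.2.1 ((e v).1, (e v).2.1)
  rw [h.1]
  rfl

theorem recoverHom_forgetHom (e : V ≃ₗ[K] A × M × C)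
    {p : (A →ₗ[K] M × C) × (A × M →ₗ[K] C) × (A →ₗ[K] C)}
    (h : chartSub e p.1 ≤ chartSub (bigDecomp e) p.2.1) :
    recoverHom (forgetHom K A M C p) = p := by
  refine Prod.ext (LinearMap.ext fun x => Prod.ext rfl ?_) rfl
  have h1 := mem_chartSub.1 (h (chartSubEquiv e p.1 x).2)
  have h2 : e (chartSubEquiv e p.1 x) = (x, p.1 x) := e.apply_symm_apply _
  rw [bigDecomp_apply, h2] at h1
  exact h1.symm

/-- The point of a stratum with given coordinates. -/
def stratumOfCoord (e : V ≃ₗ[K] A × M × C) (hi : i ≤ n) (hA : Module.finrank K A = i)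
    (hM : Module.finrank K (A × M) = n - i)
    (p : (A →ₗ[K] M) × (A × M →ₗ[K] C) × (A →ₗ[K] C)) : stratum K V n i :=
  stratumMk hi ⟨⟨chartMap e hA (recoverHom p).1, chartMap (bigDecomp e) hM p.2.1⟩,
    chartSub_recoverHom_le e p⟩ (chartSub (sumDecomp e) (assembleHom K A M C (recoverHom p)))
    (piPart_chartSub_assembleHom e _) (epsPart_chartSub_assembleHom e _)

/-- The affine charts of a stratum. -/
noncomputable def stratumHomeomorph [FiniteDimensional K C] (e : V ≃ₗ[K] A × M × C) (hi : i ≤ n)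
    (hA : Module.finrank K A = i) (hM : Module.finrank K (A × M) = n - i) :
    {L : stratum K V n i // L.1.1 ∈ chartDom (sumDecomp e) n} ≃ₜ
      AffineSp K ((A →ₗ[K] M) × (A × M →ₗ[K] C) × (A →ₗ[K] C)) where
  toFun L := forgetHom K A M C (stratumCoord e L.1)
  invFun p := ⟨stratumOfCoord e hi hA hM p,
    chartMap_mem_chartDom (sumDecomp e) (finrank_sumDecomp_source hi hA hM)
      (assembleHom K A M C (recoverHom p))⟩
  left_inv L := by
    have hL := (mem_chartDom_iff_flagOf_mem e hM L.1).1 L.2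
    refine Subtype.ext (Subtype.ext (Subtype.ext (Subtype.ext ?_)))
    change chartSub (sumDecomp e) (assembleHom K A M C
      (recoverHom (forgetHom K A M C (stratumCoord e L.1)))) = _
    rw [recoverHom_forgetHom e, chartSub_stratumCoord e hi hA hM hL]
    rw [piPart_eq_chartSub e hi hA hM hL, epsPart_eq_chartSub e hi hA hM hL]
    exact piPart_le_epsPart L.1.1.2
  right_inv p := by
    change forgetHom K A M C (splitHom K A M C (chartCoord (sumDecomp e)
      (chartSub (sumDecomp e) (assembleHom K A M C (recoverHom p))))) = p
    rw [chartCoord_chartSub, splitHom_assembleHom]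
    rfl
  continuous_toFun := ((isMorphism_linearMap (forgetHom K A M C)).comp
    (isMorphism_stratumCoord e hi hA hM)).1
  continuous_invFun := by
    refine Continuous.subtype_mk (Continuous.subtype_mk (Continuous.subtype_mk ?_ _) _) _
    exact ((isMorphism_chartMap (sumDecomp e) (finrank_sumDecomp_source hi hA hM)).comp
      ((isMorphism_linearMap (assembleHom K A M C)).comp isMorphism_recoverHom)).1

/-- The dimension is that of `Hom(A, M) × Hom(A × M, C) × Hom(A, C)`, where `A`, `M`, `C` have
dimensions `l`, `n - 2l`, `r + l - n`. The bounds on `l` make these subtractions exact, with sum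
`r`. -/
theorem exists_stratum_chart {r l : ℕ} (hr : Module.finrank K V = r) (h1 : n - r ≤ l)
    (h2 : l ≤ n / 2) : ∃ O : Set (Gr K (V × V) n), IsOpen O ∧
      Nonempty ({L : stratum K V n l // L.1.1 ∈ O} ≃ₜ
        AffineSp K (Fin (n * (r + l - n) + l * (n - 2 * l)) → K)) := by
  have e : V ≃ₗ[K] (Fin l → K) × (Fin (n - 2 * l) → K) × (Fin (r + l - n) → K) :=
    LinearEquiv.ofFinrankEq _ _ (by simp; omega)
  have hA : Module.finrank K (Fin l → K) = l := by simp
  have hM : Module.finrank K ((Fin l → K) × (Fin (n - 2 * l) → K)) = n - l := by simp; omega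
  have hl : l ≤ n := by omega
  refine ⟨chartDom (sumDecomp e) n, isOpen_chartDom _ (finrank_sumDecomp_source hl hA hM), ?_⟩
  obtain ⟨f⟩ := isMorphism_linearEquiv_homeomorph (K := K) (LinearEquiv.ofFinrankEq (R := K)
    (((Fin l → K) →ₗ[K] (Fin (n - 2 * l) → K)) ×
      ((Fin l → K) × (Fin (n - 2 * l) → K) →ₗ[K] (Fin (r + l - n) → K)) ×
      ((Fin l → K) →ₗ[K] (Fin (r + l - n) → K)))
    (Fin (n * (r + l - n) + l * (n - 2 * l)) → K) (by
      simp only [Module.finrank_prod, Module.finrank_linearMap, Module.finrank_fin_fun]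
      obtain ⟨k, rfl⟩ : ∃ k, n = l + k + l := ⟨n - 2 * l, by omega⟩
      have : l + k + l - 2 * l = k := by omega
      rw [this]
      ring))
  exact ⟨(stratumHomeomorph e hl hA hM).trans f⟩

end StratumChart

/-! ### Affine neighbourhoods in the Grassmannian. -/

section GrCharts

variable {K : Type*} [Field K] {W : Type*} [AddCommGroup W] [Module K W] [FiniteDimensional K W]
  {n : ℕ}

/-- The affine charts of a Grassmannian. -/
noncomputable def chartHomeomorph {A C : Type*} [AddCommGroup A] [Module K A] [AddCommGroup C]
    [Module K C] [FiniteDimensional K A] (e : W ≃ₗ[K] A × C) (hA : Module.finrank K A = n) :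
    chartDom e n ≃ₜ AffineSp K (A →ₗ[K] C) where
  toFun L := chartCoord e L.1.1
  invFun h := ⟨chartMap e hA h, chartMap_mem_chartDom e hA h⟩
  left_inv L := Subtype.ext (Subtype.ext (chartSub_chartCoord e hA L.2))
  right_inv h := chartCoord_chartSub e h
  continuous_toFun := (isMorphism_chartCoord e hA).1
  continuous_invFun := (isMorphism_chartMap e hA).1.subtype_mk _

theorem exists_gr_chart (L : Gr K W n) : ∃ (O : Set (Gr K W n)) (N : ℕ), IsOpen O ∧ L ∈ O ∧
    Nonempty (O ≃ₜ AffineSp K (Fin N → K)) := by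
  obtain ⟨C, hC⟩ := L.1.exists_isCompl
  let e : W ≃ₗ[K] L.1 × C := (Submodule.prodEquivOfIsCompl L.1 C hC).symm
  obtain ⟨f⟩ := isMorphism_linearEquiv_homeomorph (Module.finBasis K (L.1 →ₗ[K] C)).equivFun
  refine ⟨chartDom e n, _, isOpen_chartDom e L.2, fun x hx hx0 => ?_,
    ⟨(chartHomeomorph e L.2).trans f⟩⟩
  exact hC.disjoint.le_bot ⟨hx, (Submodule.prodEquivOfIsCompl_symm_apply_fst_eq_zero _ _ hC).1 hx0⟩

end GrCharts

/-! ### Semicontinuity and closedness. -/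

section Closed

variable {K : Type*} [Field K] {V : Type*} [AddCommGroup V] [Module K V] [FiniteDimensional K V]
  {n : ℕ}

theorem isMorphism_affine_pi {X : Type*} [TopologicalSpace X] [SpaceWithFunctions K X]
    {φ : X → Fin n → V} (h : ∀ k, IsMorphism K (Y := AffineSp K V) fun x => φ x k) :
    IsMorphism K (Y := AffineSp K (Fin n → V)) φ := by
  refine isMorphism_affine fun l x => ?_
  refine (RegularAt.sum (s := Finset.univ) fun k _ =>
    (h k).dual (l ∘ₗ LinearMap.single K (fun _ => V) k) x).congr (Eventually.of_forall fun y => ?_)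
  change ∑ k, l (Pi.single k (φ y k)) = l (φ y)
  rw [← map_sum, Finset.univ_sum_single]

theorem isMorphism_affine_smul {X : Type*} [TopologicalSpace X] [SpaceWithFunctions K X]
    {c : X → K} {φ : X → V} (hc : ∀ x, RegularAt K c x)
    (hφ : IsMorphism K (Y := AffineSp K V) φ) :
    IsMorphism K (Y := AffineSp K V) fun x => c x • φ x := by
  refine isMorphism_affine fun l x => ((hc x).mul (hφ.dual l x)).congr
    (Eventually.of_forall fun y => ?_)
  exact (l.map_smul (c y) (φ y)).symm

theorem isMorphism_frames_apply (k : Fin n) :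
    IsMorphism K (Y := AffineSp K V) (fun w : Frames K V n => (w.1 : Fin n → V) k) :=
  isMorphism_affine fun l w => regularAt_frames k l w

/-- Lower semicontinuity of rank: `m` vectors of a frame whose projections to `V` are independent
keep this property for nearby frames. -/
theorem isOpen_setOf_le_finrank_piPart (m : ℕ) :
    IsOpen {L : Gr K (V × V) n | m ≤ Module.finrank K (piPart L.1)} := by
  refine isOpen_coinduced.2 (isOpen_iff_mem_nhds.2 fun w hw => ?_)
  have hpi : ∀ w : Frames K (V × V) n, piPart (frameSpan K (V × V) n w).1 =
      Submodule.span K (range fun k => ((w.1 : Fin n → V × V) k).1) := by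
    intro w
    refine (Submodule.map_span _ _).trans ?_
    rw [← range_comp]
    rfl
  have hw : m ≤ Module.finrank K (Submodule.span K (range fun k => ((w.1 : Fin n → V × V) k).1)) :=
    (hpi w) ▸ hw
  obtain ⟨κ, hκ⟩ : ∃ κ : Fin m → Fin n,
      LinearIndependent K fun j => ((w.1 : Fin n → V × V) (κ j)).1 := by
    obtain ⟨κ, a, ha, hspan, hli⟩ :=
      exists_linearIndependent' K fun k => ((w.1 : Fin n → V × V) k).1
    have : Finite κ := Finite.of_injective a ha
    have := Fintype.ofFinite κ
    rw [← hspan, finrank_span_eq_card hli] at hw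
    obtain ⟨g⟩ := Function.Embedding.nonempty_of_card_le (α := Fin m) (β := κ) (by simpa using hw)
    exact ⟨a ∘ g, hli.comp g g.injective⟩
  have hφ : IsMorphism K (Y := AffineSp K (Fin m → V)) (fun w : Frames K (V × V) n =>
      fun j => ((w.1 : Fin n → V × V) (κ j)).1) :=
    isMorphism_affine_pi fun j =>
      (isMorphism_linearMap (LinearMap.fst K V V)).comp (isMorphism_frames_apply (κ j))
  filter_upwards [(isOpen_frames.preimage hφ.1).mem_nhds hκ] with v hv
  have hv : LinearIndependent K fun j => ((v.1 : Fin n → V × V) (κ j)).1 := hv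
  change m ≤ Module.finrank K (piPart (frameSpan K (V × V) n v).1)
  rw [hpi]
  have := finrank_span_eq_card hv
  rw [Fintype.card_fin] at this
  rw [← this]
  exact Submodule.finrank_mono (Submodule.span_mono (range_comp_subset_range κ
    fun k => ((v.1 : Fin n → V × V) k).1))

theorem isMorphism_affine_snoc {X : Type*} [TopologicalSpace X] [SpaceWithFunctions K X]
    {φ : X → Fin n → V} {ψ : X → V} (hφ : ∀ k, IsMorphism K (Y := AffineSp K V) fun x => φ x k)
    (hψ : IsMorphism K (Y := AffineSp K V) ψ) :
    IsMorphism K (Y := AffineSp K (Fin (n + 1) → V))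
      fun x => (Fin.snoc (φ x) (ψ x) : Fin (n + 1) → V) := by
  refine isMorphism_affine_pi fun j => ?_
  refine Fin.lastCases ?_ (fun j => ?_) j
  · simpa only [Fin.snoc_last] using hψ
  · simpa only [Fin.snoc_castSucc] using hφ j

/-- Instability is rewritten as the independence of `n + 1` vectors depending linearly on the frame,
which is an open condition; hence `Σ` is closed in the Grassmannian. -/
theorem not_map_span_le_iff (f : V →ₗ[K] V) {w : Fin n → V} (hw : LinearIndependent K w) :
    ¬ (Submodule.span K (range w)).map f ≤ Submodule.span K (range w) ↔
      ∃ k, LinearIndependent K (Fin.snoc w (f (w k)) : Fin (n + 1) → V) := by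
  simp only [linearIndependent_finSnoc, hw, true_and]
  rw [← not_forall, not_iff_not]
  exact (Submodule.map_span_le _ _ _).trans forall_mem_range

theorem isClosed_sigmaVar : IsClosed (SigmaVar K V n) := by
  refine ⟨isOpen_coinduced.2 (isOpen_iff_mem_nhds.2 fun w hw => ?_)⟩
  obtain ⟨k, hk⟩ := (not_map_span_le_iff (epsMul K V) w.2).1 hw
  have hφ := isMorphism_affine_snoc (fun k => isMorphism_frames_apply (K := K) (V := V × V) k)
    ((isMorphism_linearMap (epsMul K V)).comp (isMorphism_frames_apply k))
  filter_upwards [(isOpen_frames.preimage hφ.1).mem_nhds hk] with v hv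
  exact (not_map_span_le_iff (epsMul K V) v.2).2 ⟨k, hv⟩

end Closed

/-! ### A family of submodules degenerating the stratum of index `l`. -/

section Family

variable {K : Type*} [Field K] {V : Type*} [AddCommGroup V] [Module K V] [FiniteDimensional K V]
  {n l : ℕ}

theorem eq_of_piPart_le_of_epsPart_le {L L' : Submodule K (V × V)} (h : L' ≤ L)
    (h1 : piPart L ≤ piPart L') (h2 : epsPart L ≤ epsPart L') : L' = L := by
  refine le_antisymm h fun x hx => ?_
  obtain ⟨w, hw⟩ := mem_piPart.1 (h1 (mem_piPart.2 ⟨x.2, hx⟩))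
  have h3 : x - (x.1, w) = (0, x.2 - w) := Prod.ext (sub_self _) rfl
  have h4 : (0, x.2 - w) ∈ L' := h2 (mem_epsPart.2 (h3 ▸ L.sub_mem hx (h hw)))
  rw [← h3] at h4
  exact (L'.sub_mem_iff_left hw).1 h4

variable (K V) in
/-- The parameters of a family of submodules of `V ⊕ εV`. -/
abbrev FamilyParam (n l : ℕ) : Type _ :=
  (Fin l → K) × (Fin l → V) × (Fin l → V) × (Fin (n - 2 * l) → V)

/-- The vectors `t_j v_j + ε w_j`, `ε v_j` and `ε u_k` of `V ⊕ εV`. -/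
def familyVec (x : FamilyParam K V n l) : Fin l ⊕ (Fin l ⊕ Fin (n - 2 * l)) → V × V :=
  Sum.elim (fun j => (x.1 j • x.2.1 j, x.2.2.1 j))
    (Sum.elim (fun j => (0, x.2.1 j)) (fun k => (0, x.2.2.2 k)))

/-- The subspace spanned by `t_j v_j + ε w_j`, `ε v_j` and `ε u_k`. -/
def familySub (x : FamilyParam K V n l) : Submodule K (V × V) :=
  Submodule.span K (range (familyVec x))

theorem piPart_familySub (x : FamilyParam K V n l) :
    piPart (familySub x) = Submodule.span K (range fun j => x.1 j • x.2.1 j) := by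
  refine (Submodule.map_span _ _).trans (le_antisymm (Submodule.span_le.2 ?_)
    (Submodule.span_le.2 ?_))
  · rintro _ ⟨_, ⟨k, rfl⟩, rfl⟩
    rcases k with j | j | k
    · exact Submodule.subset_span ⟨j, rfl⟩
    · exact Submodule.zero_mem _
    · exact Submodule.zero_mem _
  · rintro _ ⟨j, rfl⟩
    exact Submodule.subset_span ⟨_, ⟨Sum.inl j, rfl⟩, rfl⟩

theorem map_epsMul_familySub_le (x : FamilyParam K V n l) :
    (familySub x).map (epsMul K V) ≤ familySub x := by
  refine (Submodule.map_span_le _ _ _).2 (forall_mem_range.2 ?_)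
  rintro (j | j | k)
  · have h : epsMul K V (familyVec x (Sum.inl j)) = x.1 j • familyVec x (Sum.inr (Sum.inl j)) :=
      Prod.ext (smul_zero _).symm rfl
    rw [h]
    exact Submodule.smul_mem _ _ (Submodule.subset_span ⟨_, rfl⟩)
  · exact Submodule.zero_mem _
  · exact Submodule.zero_mem _

theorem finrank_piPart_familySub_le (x : FamilyParam K V n l) :
    Module.finrank K (piPart (familySub x)) ≤ l := by
  rw [piPart_familySub]
  exact (finrank_range_le_card _).trans_eq (Fintype.card_fin l)

theorem finrank_piPart_familySub {x : FamilyParam K V n l} (hx : LinearIndependent K (familyVec x))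
    (ht : ∀ j, x.1 j ≠ 0) : Module.finrank K (piPart (familySub x)) = l := by
  have hv : LinearIndependent K x.2.1 :=
    LinearIndependent.of_comp (LinearMap.inr K V V)
      (hx.comp (fun j => Sum.inr (Sum.inl j)) (Sum.inr_injective.comp Sum.inl_injective))
  have hv' : LinearIndependent K fun j => x.1 j • x.2.1 j :=
    hv.units_smul fun j => Units.mk0 _ (ht j)
  rw [piPart_familySub, finrank_span_eq_card hv', Fintype.card_fin]

/-- Use a basis `f_a` of `F`, with lifts `f_a + ε w_a` in `L`, and a basis of a complement `M` of
`F` in `G`. The `i` indices in `F` get `t = 1`. Each of the other `l - i` indices gets `t = 0` and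
absorbs two basis vectors of `M`, one as `v_j` and one as `w_j`; the remaining ones serve as `u_k`.
-/
theorem exists_familySub_eq (hl : l ≤ n / 2) {L : Submodule K (V × V)}
    (hL : L.map (epsMul K V) ≤ L) (hn : Module.finrank K L = n) {i : ℕ}
    (hi : Module.finrank K (piPart L) = i) (hil : i ≤ l) :
    ∃ x : FamilyParam K V n l, LinearIndependent K (familyVec x) ∧ familySub x = L ∧
      (i = l → ∀ j, x.1 j ≠ 0) := by
  have hFG := piPart_le_epsPart hL
  have hG := finrank_piPart_add_finrank_epsPart L
  obtain ⟨M, hM⟩ := ((piPart L).submoduleOf (epsPart L)).exists_isCompl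
  have hMd : Module.finrank K M = n - 2 * i := by
    have := Submodule.finrank_add_eq_of_isCompl hM
    rw [(Submodule.submoduleOfEquivOfLe hFG).finrank_eq] at this
    omega
  let f := Module.finBasisOfFinrankEq K (piPart L) hi
  -- The count is `n - 2i = 2(l - i) + (n - 2l)`.
  let m := (Module.finBasisOfFinrankEq K M hMd).reindex (Fintype.equivOfCardEq (by simp; omega) :
    Fin (n - 2 * i) ≃ (Fin (l - i) ⊕ Fin (l - i)) ⊕ Fin (n - 2 * l))
  let ρ : Fin l ≃ Fin i ⊕ Fin (l - i) := Fintype.equivOfCardEq (by simp; omega)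
  choose w hw using fun j => mem_piPart.1 (f j).2
  let x : FamilyParam K V n l :=
    (fun j => Sum.elim (fun _ => 1) (fun _ => 0) (ρ j),
      fun j => Sum.elim (fun a => (f a : V)) (fun b => ((m (Sum.inl (Sum.inl b)) : epsPart L) : V))
        (ρ j),
      fun j => Sum.elim w (fun b => ((m (Sum.inl (Sum.inr b)) : epsPart L) : V)) (ρ j),
      fun k => ((m (Sum.inr k) : epsPart L) : V))
  have hmG : ∀ c, ((0 : V), ((m c : epsPart L) : V)) ∈ L := fun c => (m c : epsPart L).2
  have hle : familySub x ≤ L := by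
    refine Submodule.span_le.2 (range_subset_iff.2 ?_)
    rintro (j | j | k)
    · change (Sum.elim (fun _ => (1 : K)) (fun _ => 0) (ρ j) •
        Sum.elim (fun a => (f a : V)) (fun b => ((m (Sum.inl (Sum.inl b)) : epsPart L) : V)) (ρ j),
        Sum.elim w (fun b => ((m (Sum.inl (Sum.inr b)) : epsPart L) : V)) (ρ j)) ∈ L
      rcases ρ j with a | b
      · simpa using hw a
      · simpa using hmG _
    · change ((0 : V), Sum.elim (fun a => (f a : V))
        (fun b => ((m (Sum.inl (Sum.inl b)) : epsPart L) : V)) (ρ j)) ∈ L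
      rcases ρ j with a | b
      · exact hFG (f a).2
      · exact hmG _
    · exact hmG _
  have hvec : ∀ c, familyVec x c ∈ familySub x := fun c => Submodule.subset_span ⟨c, rfl⟩
  have hspanF : ∀ S : Submodule K V, (∀ a, (f a : V) ∈ S) → piPart L ≤ S := by
    intro S hS v hv
    have h := congrArg (piPart L).subtype (f.sum_repr ⟨v, hv⟩)
    have h' : ∑ a, f.repr ⟨v, hv⟩ a • (f a : V) = v := by
      simpa only [map_sum, map_smul, Submodule.subtype_apply] using h
    rw [← h']
    exact S.sum_mem fun a _ => S.smul_mem _ (hS a)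
  have hpi : piPart L ≤ piPart (familySub x) := hspanF _ fun a => by
    refine mem_piPart.2 ⟨w a, ?_⟩
    simpa [familyVec, x] using hvec (Sum.inl (ρ.symm (Sum.inl a)))
  have heps : epsPart L ≤ epsPart (familySub x) := by
    have h1 : piPart L ≤ epsPart (familySub x) := hspanF _ fun a => by
      refine mem_epsPart.2 ?_
      simpa [familyVec, x] using hvec (Sum.inr (Sum.inl (ρ.symm (Sum.inl a))))
    have h2 : ∀ c, ((m c : epsPart L) : V) ∈ epsPart (familySub x) := by
      rintro ((b | b) | k)
      · refine mem_epsPart.2 ?_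
        simpa [familyVec, x] using hvec (Sum.inr (Sum.inl (ρ.symm (Sum.inr b))))
      · refine mem_epsPart.2 ?_
        simpa [familyVec, x] using hvec (Sum.inl (ρ.symm (Sum.inr b)))
      · exact hvec (Sum.inr (Sum.inr k))
    intro g hg
    obtain ⟨a, ha, b, hb, hab⟩ := Submodule.mem_sup.1
      (hM.sup_eq_top ▸ Submodule.mem_top (x := (⟨g, hg⟩ : epsPart L)))
    have hg' : (a : V) + b = g := congrArg Subtype.val hab
    rw [← hg']
    refine Submodule.add_mem _ (h1 ha) ?_
    have h := congrArg (fun z => (epsPart L).subtype (M.subtype z)) (m.sum_repr ⟨b, hb⟩)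
    have h' : ∑ c, m.repr ⟨b, hb⟩ c • ((m c : epsPart L) : V) = b := by
      simpa only [map_sum, map_smul, Submodule.subtype_apply] using h
    rw [← h']
    exact Submodule.sum_mem _ fun c _ => Submodule.smul_mem _ _ (h2 c)
  have hEq := eq_of_piPart_le_of_epsPart_le hle hpi heps
  refine ⟨x, ?_, hEq, ?_⟩
  -- Independence is a count: `l + l + (n - 2l) = n` vectors span a space of dimension `n`.
  · refine linearIndependent_iff_card_eq_finrank_span.2 ?_
    change _ = Module.finrank K (familySub x)
    rw [hEq, hn]
    simp
    omega
  · rintro rfl j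
    change Sum.elim (fun _ => (1 : K)) (fun _ => 0) (ρ j) ≠ 0
    rcases ρ j with a | b
    · exact one_ne_zero
    · exact absurd b.2 (by omega)

end Family

/-! ### Closures of the strata and their dimension. -/

section Closure

variable {K : Type*} [Field K] {V : Type*} [AddCommGroup V] [Module K V] [FiniteDimensional K V]
  {n l : ℕ}

theorem isMorphism_familyVec (c : Fin l ⊕ (Fin l ⊕ Fin (n - 2 * l))) :
    IsMorphism K (X := AffineSp K (FamilyParam K V n l)) (Y := AffineSp K (V × V))
      fun x => familyVec (K := K) (V := V) x c := by
  have ht := isMorphism_linearMap (LinearMap.fst K (Fin l → K)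
    ((Fin l → V) × (Fin l → V) × (Fin (n - 2 * l) → V)))
  have hv (j : Fin l) := isMorphism_linearMap (LinearMap.proj (R := K) (φ := fun _ => V) j ∘ₗ
    LinearMap.fst K (Fin l → V) ((Fin l → V) × (Fin (n - 2 * l) → V)) ∘ₗ
    LinearMap.snd K (Fin l → K) _)
  have hw (j : Fin l) := isMorphism_linearMap (LinearMap.proj (R := K) (φ := fun _ => V) j ∘ₗ
    LinearMap.fst K (Fin l → V) (Fin (n - 2 * l) → V) ∘ₗ LinearMap.snd K (Fin l → V) _ ∘ₗ
    LinearMap.snd K (Fin l → K) _)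
  have hu (k : Fin (n - 2 * l)) := isMorphism_linearMap (LinearMap.inr K V V ∘ₗ
    LinearMap.proj (R := K) (φ := fun _ => V) k ∘ₗ
    LinearMap.snd K (Fin l → V) (Fin (n - 2 * l) → V) ∘ₗ LinearMap.snd K (Fin l → V) _ ∘ₗ
    LinearMap.snd K (Fin l → K) _)
  rcases c with j | j | k
  · exact isMorphism_affine_prodMk
      (isMorphism_affine_smul (fun x => ht.dual (LinearMap.proj j) x) (hv j)) (hw j)
  · exact (isMorphism_linearMap (LinearMap.inr K V V)).comp (hv j)
  · exact hu k

theorem isOpen_setOf_forall_ne_zero :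
    IsOpen {x : AffineSp K (FamilyParam K V n l) | ∀ j, (x : FamilyParam K V n l).1 j ≠ 0} := by
  rw [ofPred_forall]
  exact isOpen_iInter_of_finite fun j => isOpen_polyFun_ne_zero (Algebra.subset_adjoin
    ⟨LinearMap.proj j ∘ₗ LinearMap.fst K (Fin l → K) _, rfl⟩)

instance irreducibleSpace_affineSp {A : Type*} [AddCommGroup A] [Module K A]
    [FiniteDimensional K A] [IsAlgClosed K] : IrreducibleSpace (AffineSp K A) := by
  obtain ⟨f⟩ := isMorphism_linearEquiv_homeomorph (Module.finBasis K A).equivFun.symm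
  have h := isIrreducible_zeroLocus_inter (K := K) (N := Module.finrank K A) ⊥ (f := 1)
    (by simp)
  have h' : IsIrreducible (univ : Set (AffineSp K (Fin (Module.finrank K A) → K))) := by
    convert h
    refine Eq.symm (eq_univ_iff_forall.2 fun x => ⟨?_, ?_⟩)
    · rw [MvPolynomial.zeroLocus_bot]
      exact mem_univ _
    · change MvPolynomial.aeval (x : Fin (Module.finrank K A) → K) (1 : MvPolynomial _ K) ≠ 0
      simp
  have h2 := h'.image f f.continuous.continuousOn
  rw [image_univ, f.surjective.range_eq] at h2
  exact (irreducibleSpace_def _).2 h2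

/-- The vectors of the family are polynomial in the parameters. Once numbered by `σ`, they define a
morphism to `n`-tuples of vectors, and `X` is the preimage of the open set of frames. -/
theorem exists_family (hl : l ≤ n / 2) : ∃ (X : Set (AffineSp K (FamilyParam K V n l)))
    (Γ : X → SigmaVar K V n), IsOpen X ∧ Continuous Γ ∧ (∀ x, (Γ x).1.1 = familySub x.1) ∧
      ∀ x : FamilyParam K V n l, x ∈ X ↔ LinearIndependent K (familyVec x) := by
  let σ : Fin n ≃ Fin l ⊕ (Fin l ⊕ Fin (n - 2 * l)) := Fintype.equivOfCardEq (by simp; omega)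
  let φ : AffineSp K (FamilyParam K V n l) → AffineSp K (Fin n → V × V) :=
    fun x k => familyVec (K := K) (V := V) x (σ k)
  have hφ : IsMorphism K φ := isMorphism_affine_pi fun k => isMorphism_familyVec (σ k)
  have hspan : ∀ x : φ ⁻¹' Frames K (V × V) n,
      (frameSpan K (V × V) n ⟨φ x.1, x.2⟩).1 = familySub (K := K) (V := V) (n := n) (l := l) x.1 :=
    fun x => congrArg (Submodule.span K)
      (σ.surjective.range_comp (familyVec (K := K) (V := V) (n := n) (l := l) x.1))
  have hΓ : Continuous fun x : φ ⁻¹' Frames K (V × V) n => frameSpan K (V × V) n ⟨φ x.1, x.2⟩ :=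
    isMorphism_frameSpan.1.comp ((hφ.1.comp continuous_subtype_val).subtype_mk _)
  have hmem : ∀ x : φ ⁻¹' Frames K (V × V) n,
      frameSpan K (V × V) n ⟨φ x.1, x.2⟩ ∈ SigmaVar K V n := by
    intro x
    change Submodule.map _ (frameSpan K (V × V) n ⟨φ x.1, x.2⟩).1 ≤
      (frameSpan K (V × V) n ⟨φ x.1, x.2⟩).1
    rw [hspan]
    exact map_epsMul_familySub_le _
  exact ⟨φ ⁻¹' Frames K (V × V) n, fun x => ⟨frameSpan K (V × V) n ⟨φ x.1, x.2⟩, hmem x⟩,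
    isOpen_frames.preimage hφ.1, hΓ.subtype_mk hmem, hspan, fun x => linearIndependent_equiv σ⟩

theorem isClosed_setOf_finrank_piPart_le :
    IsClosed {L : SigmaVar K V n | Module.finrank K (piPart L.1.1) ≤ l} := by
  refine ⟨?_⟩
  convert (isOpen_setOf_le_finrank_piPart (K := K) (V := V) (n := n) (l + 1)).preimage
    (continuous_subtype_val (p := (· ∈ SigmaVar K V n))) using 1
  ext L
  exact (not_le (a := Module.finrank K (piPart L.1.1))).trans Nat.lt_iff_add_one_le

variable [IsAlgClosed K] {r : ℕ}

theorem stratum_nonempty (hr : Module.finrank K V = r) (h1 : n - r ≤ l) (h2 : l ≤ n / 2) :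
    (stratum K V n l).Nonempty := by
  obtain ⟨O, -, ⟨φ⟩⟩ := exists_stratum_chart (K := K) hr h1 h2
  exact ⟨_, (φ.symm (0 : Fin _ → K)).1.2⟩

/-- `Γ` maps the irreducible space `X` onto `{dim F ≤ l}` and sends the dense subset where all `t_j
≠ 0` into the stratum; both claims follow by continuity. -/
theorem closure_stratum_and_isIrreducible (hr : Module.finrank K V = r) (h1 : n - r ≤ l)
    (h2 : l ≤ n / 2) :
    closure (stratum K V n l) = {L : SigmaVar K V n | Module.finrank K (piPart L.1.1) ≤ l} ∧
      IsIrreducible (closure (stratum K V n l)) := by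
  obtain ⟨X, Γ, hX, hΓ, hsub, hmem⟩ := exists_family (K := K) (V := V) h2
  have hsurj : ∀ L : SigmaVar K V n, ∀ i, Module.finrank K (piPart L.1.1) = i → i ≤ l →
      ∃ x : X, Γ x = L ∧ (i = l → ∀ j, (x.1 : FamilyParam K V n l).1 j ≠ 0) := by
    intro L i hi hil
    obtain ⟨x, hx, hxL, ht⟩ := exists_familySub_eq h2 L.2 L.1.2 hi hil
    exact ⟨⟨x, (hmem x).2 hx⟩, Subtype.ext (Subtype.ext ((hsub _).trans hxL)), ht⟩
  obtain ⟨L, hL⟩ := stratum_nonempty (K := K) hr h1 h2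
  obtain ⟨x, -, hx⟩ := hsurj L l hL le_rfl
  have : Nonempty X := ⟨x⟩
  have : IrreducibleSpace X := isIrreducible_iff_irreducibleSpace.1
    ⟨⟨x, x.2⟩, (PreirreducibleSpace.isPreirreducible_univ.open_subset hX (subset_univ _))⟩
  -- A nonempty open subset of an irreducible space is dense. Nonemptiness is witnessed by
  -- parameters of a point of the stratum itself.
  have hdense : Dense {x : X | ∀ j, (x.1 : FamilyParam K V n l).1 j ≠ 0} :=
    (isOpen_setOf_forall_ne_zero.preimage continuous_subtype_val).dense ⟨x, hx rfl⟩
  have hcl : closure (stratum K V n l) =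
      {L : SigmaVar K V n | Module.finrank K (piPart L.1.1) ≤ l} := by
    refine subset_antisymm (closure_minimal (fun L hL => le_of_eq hL)
      isClosed_setOf_finrank_piPart_le) fun L hL => ?_
    obtain ⟨y, rfl, -⟩ := hsurj L _ rfl hL
    refine map_mem_closure hΓ (hdense y) fun z hz => ?_
    change Module.finrank K (piPart (Γ z).1.1) = l
    rw [hsub]
    exact finrank_piPart_familySub ((hmem z.1).1 z.2) hz
  refine ⟨hcl, ?_⟩
  have hr : range Γ = {L : SigmaVar K V n | Module.finrank K (piPart L.1.1) ≤ l} := by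
    refine subset_antisymm (range_subset_iff.2 fun y => ?_) fun L hL => ?_
    · change Module.finrank K (piPart (Γ y).1.1) ≤ l
      rw [hsub]
      exact finrank_piPart_familySub_le _
    · obtain ⟨y, hy, -⟩ := hsurj L _ rfl hL
      exact ⟨y, hy⟩
  rw [hcl, ← hr, ← image_univ]
  exact (IrreducibleSpace.isIrreducible_univ X).image Γ hΓ.continuousOn

theorem topologicalKrullDim_closure_stratum (hr : Module.finrank K V = r) (h1 : n - r ≤ l)
    (h2 : l ≤ n / 2) : topologicalKrullDim (closure (stratum K V n l)) =
      ((n * (r + l - n) + l * (n - 2 * l) : ℕ) : WithBot ℕ∞) := by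
  obtain ⟨hcl, hirr⟩ := closure_stratum_and_isIrreducible (K := K) hr h1 h2
  have : IrreducibleSpace (closure (stratum K V n l)) :=
    isIrreducible_iff_irreducibleSpace.1 hirr
  let J : closure (stratum K V n l) → Gr K (V × V) n := fun x => x.1.1
  have hJ : IsClosedEmbedding J :=
    isClosed_sigmaVar.isClosedEmbedding_subtypeVal.comp isClosed_closure.isClosedEmbedding_subtypeVal
  obtain ⟨O, hO, ⟨φ⟩⟩ := exists_stratum_chart (K := K) hr h1 h2
  -- On the closure `dim F ≤ l` holds, so belonging to the stratum amounts to the open condition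
  -- `dim F ≥ l`.
  have hO' : {x : closure (stratum K V n l) | x.1 ∈ stratum K V n l ∧ x.1.1 ∈ O} =
      J ⁻¹' ({L | l ≤ Module.finrank K (piPart L.1)} ∩ O) := by
    ext x
    have hx : Module.finrank K (piPart x.1.1.1) ≤ l := hcl.subset x.2
    exact and_congr_left fun _ => ⟨fun h => ge_of_eq h, fun h => le_antisymm hx h⟩
  refine topologicalKrullDim_eq_of_charts (fun x => ?_)
    (O' := {x : closure (stratum K V n l) | x.1 ∈ stratum K V n l ∧ x.1.1 ∈ O})
    (hO' ▸ ((isOpen_setOf_le_finrank_piPart l).inter hO).preimage hJ.continuous)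
    (Homeomorph.trans ?_ φ)
  -- The closure is closed in the Grassmannian, so its trace on an affine chart of the Grassmannian
  -- is closed in an affine space.
  · obtain ⟨U, N, hU, hxU, ⟨ψ⟩⟩ := exists_gr_chart (J x)
    exact ⟨J ⁻¹' U, N, ψ ∘ U.restrictPreimage J, hU.preimage hJ.continuous, hxU,
      ψ.isClosedEmbedding.comp (hJ.restrictPreimage U)⟩
  · exact {
      toFun x := ⟨⟨x.1.1, x.2.1⟩, x.2.2⟩
      invFun L := ⟨⟨L.1.1, subset_closure L.1.2⟩, L.1.2, L.2⟩
      left_inv _ := rfl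
      right_inv _ := rfl
      continuous_toFun := by fun_prop
      continuous_invFun := by fun_prop }

/-- The lower bound `n - r` on the index is automatic, since `dim F = n - dim G` and `dim G ≤ r`. -/
theorem mem_iUnion_stratum (hr : Module.finrank K V = r) (L : SigmaVar K V n) :
    L ∈ ⋃ i ∈ Set.Icc (n - r) l, stratum K V n i ↔ Module.finrank K (piPart L.1.1) ≤ l := by
  have h := finrank_piPart_add_finrank_epsPart L.1.1
  have h1 : Module.finrank K L.1.1 = n := L.1.2
  have h2 := (epsPart L.1.1).finrank_le
  simp only [mem_iUnion, exists_prop]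
  refine ⟨?_, fun h => ⟨_, ⟨by omega, h⟩, rfl⟩⟩
  rintro ⟨i, hi, hL⟩
  exact (show Module.finrank K (piPart L.1.1) = i from hL).trans_le hi.2

theorem finrank_piPart_le_half (L : SigmaVar K V n) :
    Module.finrank K (piPart L.1.1) ≤ n / 2 := by
  have h := finrank_piPart_add_finrank_epsPart L.1.1
  have h1 : Module.finrank K L.1.1 = n := L.1.2
  have h2 := Submodule.finrank_mono (piPart_le_epsPart L.2)
  omega

end Closure

theorem mainTheorem6 (K : Type*) [Field K] [IsAlgClosed K]
    (V : Type*) [AddCommGroup V] [Module K V] [FiniteDimensional K V]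
    (r n : ℕ) (hr : Module.finrank K V = r) :
    -- the strata are pairwise disjoint and cover `Σ`; note that `max 0 (n - r)` is `n - r` in `ℕ`
    ((⋃ i ∈ Set.Icc (n - r) (n / 2), stratum K V n i) = Set.univ ∧
      (Set.Icc (n - r) (n / 2)).PairwiseDisjoint (stratum K V n)) ∧
    -- each stratum is a vector bundle over the flag variety, with fibres `Hom(F, V / G)`
    (∀ i ∈ Set.Icc (n - r) (n / 2),
      ∃ θ : ∀ b : FlagVar K V i (n - i),
          (b.1.fst.1 →ₗ[K] V ⧸ b.1.snd.1) ≃ {L : stratum K V n i // flagOf L = b},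
        (∀ b φ, (θ b φ).1.1.1.1 = homSubmodule b.1.fst.1 b.1.snd.1 φ) ∧
        IsVectorBundle K (flagOf : stratum K V n i → FlagVar K V i (n - i))
          (fun b => b.1.fst.1 →ₗ[K] V ⧸ b.1.snd.1) θ) ∧
    -- closures of the strata in `Σ`, and their dimensions (no subtraction truncates here)
    (∀ l ∈ Set.Icc (n - r) (n / 2),
      (closure (stratum K V n l) = ⋃ i ∈ Set.Icc (n - r) l, stratum K V n i) ∧
      topologicalKrullDim (closure (stratum K V n l)) =
        ((n * (r + l - n) + l * (n - 2 * l) : ℕ) : WithBot ℕ∞)) := by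
  refine ⟨⟨eq_univ_of_forall fun L => (mem_iUnion_stratum hr L).2 (finrank_piPart_le_half L),
    fun i _ j _ hij => disjoint_left.2 fun L hi hj => hij (hi.symm.trans hj)⟩, fun i hi => ?_,
    fun l hl => ⟨?_, topologicalKrullDim_closure_stratum hr hl.1 hl.2⟩⟩
  · have hin : i ≤ n := hi.2.trans (Nat.div_le_self n 2)
    exact ⟨fiberEquiv hin, fun b φ => rfl, isVectorBundle_flagOf hin⟩
  · rw [(closure_stratum_and_isIrreducible hr hl.1 hl.2).1]
    exact ext fun L => (mem_iUnion_stratum hr L).symm
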